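/- Let $k$ be a field of characteristic zero, let $m,n\geq 2$ be integers with greatest common divisor $d=(m,n)$, and let $q,\overline q\in k$ be primitive roots of unity of order $m$ and $n$ respectively. Write $U_d(k)=\{\sigma\in k \mid \sigma^d=1\}$. Let $T_{m^2}(q)$ be the Taft Hopf algebra generated by $h,x$ subject to $h^m=1$, $x^m=0$, $xh=q\,hx$, with $\Delta(h)=h\otimes h$, $\Delta(x)=x\otimes h+1\otimes x$, $\varepsilon(h)=1$, $\varepsilon(x)=0$, $S(h)=h^{-1}$, $S(x)=-xh^{-1}$, and let $\mathbb T_{n^2}(\overline q)$ be the Taft Hopf algebra for $(n,\overline q)$, with generators $H,X$. A Hopf algebra $E$ over $k$ factors through Hopf algebras $A$ and $L$ if there are injective Hopf algebra maps $i:A\to E$, $j:L\to E$ such that $A\otimes L\to E$, $a\otimes l\mapsto i(a)j(l)$, is bijective. For $\sigma\in U_d(k)$ let $\mathrm T^{\sigma}_{n,m}(\overline q,q)$ be the Hopf algebra generated by $h,x,H,X$ subject to $$h^m=H^n=1,\quad x^m=X^n=0,\quad xh=q\,hx,\quad XH=\overline q\,HX,$$ $$xH=\sigma Hx,\quad hX=\sigma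 Xh,\quad xX=\sigma Xx,\quad hH=Hh.$$ For $m=n$ and $\alpha\in k^*$ let $\mathrm Q^{\alpha}_n(q)$ be the Hopf algebra generated by $h,x,H,X$ subject to $$h^n=H^n=1,\quad x^n=X^n=0,\quad xh=q\,hx,\quad XH=q^{n-1}HX,$$ $$xH=q\,Hx,\quad hX=q\,Xh,\quad xX-q\,Xx=\alpha(1-Hh),\quad hH=Hh.$$ In both, $h,H$ are group-like, $\Delta(x)=x\otimes h+1\otimes x$, $\Delta(X)=X\otimes H+1\otimes X$, $\varepsilon(x)=\varepsilon(X)=0$, and the antipode is $S(h)=h^{m-1}$, $S(H)=H^{n-1}$, $S(x)=-q^{m-1}h^{m-1}x$, $S(X)=-\overline q^{\,n-1}H^{n-1}X$ (with $m=n$ and $\overline q=q^{n-1}$ for $\mathrm Q^{\alpha}_n(q)$). 1) If $m\neq n$ or $\overline q\neq q^{n-1}$, then a Hopf algebra $E$ over $k$ factors through $\mathbb T_{n^2}(\overline q)$ and $T_{m^2}(q)$ if and only if $E\cong \mathrm T^{\sigma}_{n,m}(\overline q,q)$ for some $\sigma\in U_d(k)$. 2) If $m=n$ and $\overline q=q^{n-1}$,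 then a Hopf algebra $E$ over $k$ factors through $\mathbb T_{n^2}(q^{n-1})$ and $T_{n^2}(q)$ if and only if $E\cong \mathrm T^{\sigma}_{n,n}(q^{n-1},q)$ for some $\sigma\in U_n(k)$ or $E\cong\mathrm Q^{\alpha}_n(q)$ for some $\alpha\in k^*$. -/

import Mathlib

open scoped TensorProduct

noncomputable section

namespace TaftBicrossed

/-! ### Nilpotency of a sum of two `q`-commuting nilpotent elements -/

/-- Gaussian binomial coefficients, through the `q`-Pascal recursion. -/
def qChoose {k : Type*} [Field k] (q : k) : ℕ → ℕ → k
  | _, 0 => 1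
  | 0, _ + 1 => 0
  | n + 1, j + 1 => qChoose q n j + q ^ (j + 1) * qChoose q n (j + 1)

theorem qChoose_zero_right {k : Type*} [Field k] (q : k) (n : ℕ) : qChoose q n 0 = 1 := by
  cases n <;> simp [qChoose]

theorem qChoose_eq_zero {k : Type*} [Field k] (q : k) (n : ℕ) :
    ∀ j, n < j → qChoose q n j = 0 := by
  induction n with
  | zero => intro j hj; obtain ⟨j, rfl⟩ := Nat.exists_eq_succ_of_ne_zero hj.ne'; simp [qChoose]
  | succ n ih =>
    intro j hj
    obtain ⟨j, rfl⟩ := Nat.exists_eq_succ_of_ne_zero (show j ≠ 0 by omega)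
    simp [qChoose, ih j (by omega), ih (j + 1) (by omega)]

theorem qChoose_rec {k : Type*} [Field k] (q : k) (n : ℕ) :
    ∀ j, q ^ j * (q ^ (j + 1) - 1) * qChoose q n (j + 1) = (q ^ n - q ^ j) * qChoose q n j := by
  induction n with
  | zero => intro j; cases j <;> simp [qChoose]
  | succ n ih =>
    intro j
    cases j with
    | zero =>
      have h := ih 0
      simp only [qChoose, qChoose_zero_right] at h ⊢
      linear_combination q * h
    | succ j =>
      have h0 := ih j
      have h1 := ih (j + 1)
      simp only [qChoose] at h0 h1 ⊢
      linear_combination q ^ (j + 2) * h1 + q * h0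

theorem qChoose_primitive {k : Type*} [Field k] {q : k} {m : ℕ} (hq : IsPrimitiveRoot q m) :
    ∀ j, j + 1 < m → qChoose q m (j + 1) = 0 := by
  intro j
  induction j with
  | zero =>
    intro hj
    have h := qChoose_rec q m 0
    have h1 : q ^ (0 + 1) - 1 ≠ 0 := sub_ne_zero.2 (hq.pow_ne_one_of_pos_of_lt (by omega) hj)
    rw [hq.pow_eq_one, pow_zero, sub_self, zero_mul, one_mul] at h
    exact (mul_eq_zero.1 h).resolve_left h1
  | succ j ih =>
    intro hj
    have h := qChoose_rec q m (j + 1)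
    have h1 : q ^ (j + 1 + 1) - 1 ≠ 0 := sub_ne_zero.2 (hq.pow_ne_one_of_pos_of_lt (by omega) hj)
    have h2 : q ^ (j + 1) ≠ 0 := pow_ne_zero _ (hq.ne_zero (by omega))
    rw [ih (by omega), mul_zero] at h
    exact (mul_eq_zero.1 h).resolve_left (mul_ne_zero h2 h1)

theorem mul_pow_of_qcomm {k B : Type*} [Field k] [Ring B] [Algebra k B] {q : k} {a b : B}
    (hba : b * a = q • (a * b)) (i : ℕ) : b * a ^ i = q ^ i • (a ^ i * b) := by
  induction i with
  | zero => simp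
  | succ i ih =>
    rw [pow_succ, ← mul_assoc, ih, smul_mul_assoc, mul_assoc, hba, mul_smul_comm, smul_smul,
      pow_succ, mul_assoc]

theorem add_pow_of_qcomm {k B : Type*} [Field k] [Ring B] [Algebra k B] {q : k} {a b : B}
    (hba : b * a = q • (a * b)) (n : ℕ) :
    (a + b) ^ n =
      ∑ p ∈ Finset.HasAntidiagonal.antidiagonal n, qChoose q n p.1 • (a ^ p.1 * b ^ p.2) := by
  induction n with
  | zero => simp [qChoose]
  | succ n ih =>
    have h2 : ∑ p ∈ Finset.HasAntidiagonal.antidiagonal n, (qChoose q n p.1 * q ^ p.1) • (a ^ p.1 * b ^ (p.2 + 1))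
        = ∑ p ∈ Finset.HasAntidiagonal.antidiagonal (n + 1), (qChoose q n p.1 * q ^ p.1) • (a ^ p.1 * b ^ p.2) := by
      rw [Finset.Nat.sum_antidiagonal_succ']
      simp [qChoose_eq_zero q n (n + 1) (by omega)]
    rw [pow_succ', ih, add_mul, Finset.mul_sum, Finset.mul_sum]
    have h3 : ∀ p ∈ Finset.HasAntidiagonal.antidiagonal n, b * qChoose q n p.1 • (a ^ p.1 * b ^ p.2) =
        (qChoose q n p.1 * q ^ p.1) • (a ^ p.1 * b ^ (p.2 + 1)) := by
      intro p _
      rw [mul_smul_comm, ← mul_assoc, mul_pow_of_qcomm hba, smul_mul_assoc, smul_smul, mul_assoc,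
        ← pow_succ']
    rw [Finset.sum_congr rfl h3, h2, Finset.Nat.sum_antidiagonal_succ,
      Finset.Nat.sum_antidiagonal_succ, add_left_comm, ← Finset.sum_add_distrib]
    congr 1
    · simp [qChoose_zero_right]
    · refine Finset.sum_congr rfl fun p _ => ?_
      rw [mul_smul_comm, ← mul_assoc, ← pow_succ', ← add_smul]
      simp only [qChoose]
      ring_nf

theorem add_pow_eq_zero_of_qcomm {k B : Type*} [Field k] [Ring B] [Algebra k B] {q : k} {m : ℕ}
    (hq : IsPrimitiveRoot q m) {a b : B} (hba : b * a = q • (a * b))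
    (ha : a ^ m = 0) (hb : b ^ m = 0) : (a + b) ^ m = 0 := by
  rw [add_pow_of_qcomm hba]
  refine Finset.sum_eq_zero fun p hp => ?_
  rw [Finset.HasAntidiagonal.mem_antidiagonal] at hp
  obtain ⟨i, j⟩ := p
  simp only at hp ⊢
  rcases Nat.eq_zero_or_pos i with rfl | hi
  · simp [show j = m by omega, hb]
  rcases Nat.eq_zero_or_pos j with rfl | hj
  · simp [show i = m by omega, ha]
  obtain ⟨i, rfl⟩ := Nat.exists_eq_succ_of_ne_zero hi.ne'
  rw [qChoose_primitive hq i (by omega), zero_smul]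

theorem mul_pow_eq_zero_of_qcomm {k B : Type*} [Field k] [Ring B] [Algebra k B] {q : k} {m : ℕ}
    {a b : B} (hba : b * a = q • (a * b)) (ha : a ^ m = 0) : (a * b) ^ m = 0 := by
  have key : ∀ i : ℕ, ∃ c : k, (a * b) ^ i = c • (a ^ i * b ^ i) := by
    intro i
    induction i with
    | zero => exact ⟨1, by simp⟩
    | succ i ih =>
      obtain ⟨c, hc⟩ := ih
      refine ⟨c * q ^ i, ?_⟩
      rw [pow_succ', hc, mul_smul_comm, mul_assoc, ← mul_assoc b, mul_pow_of_qcomm hba,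
        smul_mul_assoc, mul_smul_comm, smul_smul, pow_succ' a, pow_succ' b]
      simp only [mul_assoc]
  obtain ⟨c, hc⟩ := key m
  rw [hc, ha, zero_mul, smul_zero]

/-! ### The antipode axioms may be checked on algebra generators -/

theorem antipode_left_of_adjoin {k A : Type*} [Field k] [Ring A] [Bialgebra k A]
    (S : A →ₗ[k] A) (hS1 : S 1 = 1) (hS : ∀ a b, S (a * b) = S b * S a)
    {s : Set A} (hs : Algebra.adjoin k s = ⊤)
    (h : ∀ a ∈ s, LinearMap.mul' k A (S.rTensor A (Coalgebra.comul a)) =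
      algebraMap k A (Coalgebra.counit a)) :
    LinearMap.mul' k A ∘ₗ S.rTensor A ∘ₗ Coalgebra.comul =
      Algebra.linearMap k A ∘ₗ Coalgebra.counit := by
  have key : ∀ t u : A ⊗[k] A, ∀ c : k, LinearMap.mul' k A (S.rTensor A t) = algebraMap k A c →
      LinearMap.mul' k A (S.rTensor A (t * u)) =
        algebraMap k A c * LinearMap.mul' k A (S.rTensor A u) := by
    intro t u c ht
    induction u using TensorProduct.induction_on with
    | zero => simp
    | add u v hu hv => simp only [mul_add, map_add, hu, hv]
    | tmul b b' =>
      have : ∀ t : A ⊗[k] A, LinearMap.mul' k A (S.rTensor A (t * b ⊗ₜ b')) =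
          S b * LinearMap.mul' k A (S.rTensor A t) * b' := by
        intro t
        induction t using TensorProduct.induction_on with
        | zero => simp
        | add u v hu hv => simp only [add_mul, mul_add, map_add, hu, hv]
        | tmul c c' => simp [hS, mul_assoc]
      rw [this, ht, ← Algebra.commutes]
      simp [mul_assoc]
  ext a
  have ha : a ∈ Algebra.adjoin k s := hs ▸ Algebra.mem_top
  induction ha using Algebra.adjoin_induction with
  | mem x hx => exact h x hx
  | algebraMap r =>
    simp [Algebra.algebraMap_eq_smul_one, Algebra.TensorProduct.one_def, hS1]
  | add x y _ _ hx hy => rw [map_add, map_add, hx, hy]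
  | mul x y _ _ hx hy =>
    simp only [LinearMap.comp_apply, Algebra.linearMap_apply, Bialgebra.comul_mul,
      Bialgebra.counit_mul, map_mul] at hx hy ⊢
    rw [key _ _ _ hx, hy]

theorem antipode_right_of_adjoin {k A : Type*} [Field k] [Ring A] [Bialgebra k A]
    (S : A →ₗ[k] A) (hS1 : S 1 = 1) (hS : ∀ a b, S (a * b) = S b * S a)
    {s : Set A} (hs : Algebra.adjoin k s = ⊤)
    (h : ∀ a ∈ s, LinearMap.mul' k A (S.lTensor A (Coalgebra.comul a)) =
      algebraMap k A (Coalgebra.counit a)) :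
    LinearMap.mul' k A ∘ₗ S.lTensor A ∘ₗ Coalgebra.comul =
      Algebra.linearMap k A ∘ₗ Coalgebra.counit := by
  have key : ∀ t u : A ⊗[k] A, ∀ c : k, LinearMap.mul' k A (S.lTensor A u) = algebraMap k A c →
      LinearMap.mul' k A (S.lTensor A (t * u)) =
        LinearMap.mul' k A (S.lTensor A t) * algebraMap k A c := by
    intro t u c hu
    induction t using TensorProduct.induction_on with
    | zero => simp
    | add u v hu hv => simp only [add_mul, map_add, hu, hv]
    | tmul b b' =>
      have : ∀ u : A ⊗[k] A, LinearMap.mul' k A (S.lTensor A (b ⊗ₜ b' * u)) =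
          b * LinearMap.mul' k A (S.lTensor A u) * S b' := by
        intro t
        induction t using TensorProduct.induction_on with
        | zero => simp
        | add u v hu hv => simp only [add_mul, mul_add, map_add, hu, hv]
        | tmul c c' => simp [hS, mul_assoc]
      rw [this, hu, mul_assoc, Algebra.commutes]
      simp [mul_assoc]
  ext a
  have ha : a ∈ Algebra.adjoin k s := hs ▸ Algebra.mem_top
  induction ha using Algebra.adjoin_induction with
  | mem x hx => exact h x hx
  | algebraMap r =>
    simp [Algebra.algebraMap_eq_smul_one, Algebra.TensorProduct.one_def, hS1]
  | add x y _ _ hx hy => rw [map_add, map_add, hx, hy]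
  | mul x y _ _ hx hy =>
    simp only [LinearMap.comp_apply, Algebra.linearMap_apply, Bialgebra.comul_mul,
      Bialgebra.counit_mul, map_mul] at hx hy ⊢
    rw [key _ _ _ hy, hx]

theorem adjoin_ringQuot {k G : Type*} [Field k]
    (r : FreeAlgebra k G → FreeAlgebra k G → Prop) :
    Algebra.adjoin k (Set.range fun g : G => RingQuot.mkAlgHom k r (FreeAlgebra.ι k g)) = ⊤ := by
  have h := congrArg (Subalgebra.map (RingQuot.mkAlgHom k r)) (FreeAlgebra.adjoin_range_ι k G)
  rw [AlgHom.map_adjoin, ← Set.range_comp, Algebra.map_top,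
    (AlgHom.range_eq_top _).2 (RingQuot.mkAlgHom_surjective k r)] at h
  exact h

/-! ### The Taft algebra -/

section Taft

/-- The two generators of a Taft algebra. -/
inductive TaftGen
  | h
  | x

/-- The defining relations `h ^ m = 1`, `x ^ m = 0`, `x h = q h x` of the Taft algebra. -/
inductive TaftRel {k : Type*} [Field k] (m : ℕ) (q : k) :
    FreeAlgebra k TaftGen → FreeAlgebra k TaftGen → Prop
  | h_pow : TaftRel m q (FreeAlgebra.ι k .h ^ m) 1
  | x_pow : TaftRel m q (FreeAlgebra.ι k .x ^ m) 0
  | x_mul_h : TaftRel m q (FreeAlgebra.ι k .x * FreeAlgebra.ι k .h)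
      (q • (FreeAlgebra.ι k .h * FreeAlgebra.ι k .x))

/-- The Taft algebra `T_{m²}(q)` for a primitive `m`-th root of unity `q`: the `k`-algebra generated
by `h` and `x` subject to `h ^ m = 1`, `x ^ m = 0`, `x h = q h x`. Its Hopf algebra structure
(`h` group-like, `x` an `(h, 1)`-primitive element) is the instance given below. -/
def Taft {k : Type*} [Field k] {m : ℕ} {q : k} (_hq : IsPrimitiveRoot q m) : Type _ :=
  RingQuot (TaftRel m q)

namespace Taft

variable {k : Type*} [Field k] {m : ℕ} {q : k} (hq : IsPrimitiveRoot q m)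

instance : Ring (Taft hq) := inferInstanceAs (Ring (RingQuot (TaftRel m q)))

instance : Algebra k (Taft hq) := inferInstanceAs (Algebra k (RingQuot (TaftRel m q)))

/-- The class of a generator in the Taft algebra. -/
def gen (g : TaftGen) : Taft hq := RingQuot.mkAlgHom k (TaftRel m q) (FreeAlgebra.ι k g)

/-- The generator `h`. -/
def h : Taft hq := gen hq .h

/-- The generator `x`. -/
def x : Taft hq := gen hq .x

theorem h_pow : h hq ^ m = 1 := by
  have := RingQuot.mkAlgHom_rel k (TaftRel.h_pow (m := m) (q := q))
  rw [map_pow, map_one] at this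
  exact this

theorem x_pow : x hq ^ m = 0 := by
  have := RingQuot.mkAlgHom_rel k (TaftRel.x_pow (m := m) (q := q))
  rw [map_pow, map_zero] at this
  exact this

theorem x_mul_h : x hq * h hq = q • (h hq * x hq) := by
  have := RingQuot.mkAlgHom_rel k (TaftRel.x_mul_h (m := m) (q := q))
  rw [map_smul, map_mul, map_mul] at this
  exact this

/-- The universal property of the Taft algebra. -/
def lift {B : Type*} [Ring B] [Algebra k B] (a b : B) (h1 : a ^ m = 1) (h2 : b ^ m = 0)
    (h3 : b * a = q • (a * b)) : Taft hq →ₐ[k] B :=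
  RingQuot.liftAlgHom k ⟨FreeAlgebra.lift k (fun g => TaftGen.casesOn g a b), by
    intro u v huv
    cases huv <;> simpa⟩

@[simp]
theorem lift_h {B : Type*} [Ring B] [Algebra k B] (a b : B) (h1 : a ^ m = 1) (h2 : b ^ m = 0)
    (h3 : b * a = q • (a * b)) : lift hq a b h1 h2 h3 (h hq) = a :=
  (RingQuot.liftAlgHom_mkAlgHom_apply _ _ _ _).trans (by simp)

@[simp]
theorem lift_x {B : Type*} [Ring B] [Algebra k B] (a b : B) (h1 : a ^ m = 1) (h2 : b ^ m = 0)
    (h3 : b * a = q • (a * b)) : lift hq a b h1 h2 h3 (x hq) = b :=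
  (RingQuot.liftAlgHom_mkAlgHom_apply _ _ _ _).trans (by simp)

theorem adjoin_gen : Algebra.adjoin k (Set.range (gen hq)) = ⊤ :=
  adjoin_ringQuot (TaftRel m q)

theorem algHom_ext {B : Type*} [Semiring B] [Algebra k B] {f g : Taft hq →ₐ[k] B}
    (hh : f (h hq) = g (h hq)) (hx : f (x hq) = g (x hq)) : f = g := by
  refine AlgHom.ext_of_adjoin_eq_top (adjoin_gen hq) ?_
  rintro _ ⟨_ | _, rfl⟩
  exacts [hh, hx]

/-- The comultiplication: `Δ h = h ⊗ h` and `Δ x = x ⊗ h + 1 ⊗ x`. -/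
def comulHom : Taft hq →ₐ[k] Taft hq ⊗[k] Taft hq :=
  lift hq (h hq ⊗ₜ h hq) (x hq ⊗ₜ h hq + 1 ⊗ₜ x hq)
    (by rw [Algebra.TensorProduct.tmul_pow, h_pow, Algebra.TensorProduct.one_def])
    (add_pow_eq_zero_of_qcomm hq
      (by simp [Algebra.TensorProduct.tmul_mul_tmul, x_mul_h])
      (by simp [Algebra.TensorProduct.tmul_pow, x_pow])
      (by simp [Algebra.TensorProduct.tmul_pow, x_pow]))
    (by simp [Algebra.TensorProduct.tmul_mul_tmul, x_mul_h, add_mul, mul_add,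
          TensorProduct.smul_tmul'])

variable [NeZero m]

/-- The counit: `ε h = 1` and `ε x = 0`. -/
def counitHom : Taft hq →ₐ[k] k :=
  lift hq 1 0 (one_pow m) (zero_pow (NeZero.ne m)) (by simp)

instance : Bialgebra k (Taft hq) :=
  Bialgebra.ofAlgHom (comulHom hq) (counitHom hq)
    (by apply algHom_ext <;>
      simp [comulHom, TensorProduct.add_tmul, TensorProduct.tmul_add,
        Algebra.TensorProduct.one_def, add_assoc])
    (by apply algHom_ext <;> simp [comulHom, counitHom])
    (by apply algHom_ext <;> simp [comulHom, counitHom])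

theorem comul_h : Coalgebra.comul (R := k) (h hq) = h hq ⊗ₜ h hq :=
  lift_h hq _ _ _ _ _

theorem comul_x : Coalgebra.comul (R := k) (x hq) = x hq ⊗ₜ h hq + 1 ⊗ₜ x hq :=
  lift_x hq _ _ _ _ _

theorem counit_h : Coalgebra.counit (R := k) (h hq) = 1 :=
  lift_h hq _ _ _ _ _

theorem counit_x : Coalgebra.counit (R := k) (x hq) = 0 :=
  lift_x hq _ _ _ _ _

theorem h_mul_pow : h hq * h hq ^ (m - 1) = 1 := by
  rw [← pow_succ', Nat.sub_add_cancel (NeZero.one_le), h_pow]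

theorem h_pow_mul : h hq ^ (m - 1) * h hq = 1 := by
  rw [← pow_succ, Nat.sub_add_cancel (NeZero.one_le), h_pow]

theorem hinv_mul_x : h hq ^ (m - 1) * x hq = q • (x hq * h hq ^ (m - 1)) := by
  calc h hq ^ (m - 1) * x hq = h hq ^ (m - 1) * (x hq * h hq) * h hq ^ (m - 1) := by
        rw [mul_assoc, mul_assoc, h_mul_pow, mul_one]
    _ = q • (x hq * h hq ^ (m - 1)) := by
        rw [x_mul_h, mul_smul_comm, ← mul_assoc, h_pow_mul, one_mul, smul_mul_assoc]

/-- The antipode as a homomorphism to the opposite algebra: `S h = h⁻¹ = h ^ (m - 1)` and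
`S x = - x h⁻¹`. -/
def antipodeHom : Taft hq →ₐ[k] (Taft hq)ᵐᵒᵖ :=
  lift hq (MulOpposite.op (h hq ^ (m - 1))) (MulOpposite.op (-(x hq * h hq ^ (m - 1))))
    (by rw [← MulOpposite.op_pow, ← pow_mul, mul_comm, pow_mul, h_pow, one_pow,
      MulOpposite.op_one])
    (by
      rw [← MulOpposite.op_pow, neg_pow, mul_pow_eq_zero_of_qcomm (hinv_mul_x hq) (x_pow hq),
        mul_zero, MulOpposite.op_zero])
    (by
      rw [← MulOpposite.op_mul, ← MulOpposite.op_mul, ← MulOpposite.op_smul, mul_neg, neg_mul,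
        ← mul_assoc, hinv_mul_x, smul_neg, smul_mul_assoc])

instance : HopfAlgebra k (Taft hq) where
  antipode := (MulOpposite.opLinearEquiv k).symm.toLinearMap ∘ₗ (antipodeHom hq).toLinearMap
  mul_antipode_rTensor_comul := by
    refine antipode_left_of_adjoin _ (by simp) (by simp) (adjoin_gen hq) ?_
    rintro _ ⟨_ | _, rfl⟩
    · change LinearMap.mul' k _ (LinearMap.rTensor _ _ (Coalgebra.comul (h hq))) =
        algebraMap k _ (Coalgebra.counit (h hq))
      rw [comul_h, counit_h]
      simp [antipodeHom, h_pow_mul]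
    · change LinearMap.mul' k _ (LinearMap.rTensor _ _ (Coalgebra.comul (x hq))) =
        algebraMap k _ (Coalgebra.counit (x hq))
      rw [comul_x, counit_x]
      simp [antipodeHom, h_pow_mul, mul_assoc]
  mul_antipode_lTensor_comul := by
    refine antipode_right_of_adjoin _ (by simp) (by simp) (adjoin_gen hq) ?_
    rintro _ ⟨_ | _, rfl⟩
    · change LinearMap.mul' k _ (LinearMap.lTensor _ _ (Coalgebra.comul (h hq))) =
        algebraMap k _ (Coalgebra.counit (h hq))
      rw [comul_h, counit_h]
      simp [antipodeHom, h_mul_pow]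
    · change LinearMap.mul' k _ (LinearMap.lTensor _ _ (Coalgebra.comul (x hq))) =
        algebraMap k _ (Coalgebra.counit (x hq))
      rw [comul_x, counit_x]
      simp [antipodeHom]

theorem antipode_h : HopfAlgebra.antipode k (h hq) = h hq ^ (m - 1) := by
  change MulOpposite.unop (antipodeHom hq (h hq)) = _
  simp [antipodeHom]

theorem antipode_x : HopfAlgebra.antipode k (x hq) = -(x hq * h hq ^ (m - 1)) := by
  change MulOpposite.unop (antipodeHom hq (x hq)) = _
  simp [antipodeHom]

end Taft

end Taft

/-! ### The Hopf algebras generated by two Taft algebras -/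

section TwoTaft

/-- The generators `h`, `x`, `H`, `X`. -/
inductive TwoTaftGen
  | h
  | x
  | H
  | X

/-- Four elements `h`, `x`, `H`, `X` of a `k`-algebra satisfy the relations
`h ^ m = H ^ n = 1`, `x ^ m = X ^ n = 0`, `x h = q h x`, `X H = q' H X`,
`x H = σ H x`, `h X = σ X h`, `x X - σ X x = α (1 - H h)`, `h H = H h`. -/
structure TwoTaftRelations {k B : Type*} [Field k] [Ring B] [Algebra k B] (m n : ℕ)
    (q q' σ α : k) (h x H X : B) : Prop where
  h_pow : h ^ m = 1
  H_pow : H ^ n = 1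
  x_pow : x ^ m = 0
  X_pow : X ^ n = 0
  x_mul_h : x * h = q • (h * x)
  X_mul_H : X * H = q' • (H * X)
  x_mul_H : x * H = σ • (H * x)
  h_mul_X : h * X = σ • (X * h)
  x_mul_X : x * X - σ • (X * x) = α • (1 - H * h)
  h_mul_H : h * H = H * h

open FreeAlgebra in
/-- The relations of `TwoTaftRelations`, imposed on the generators of a free algebra. -/
inductive TwoTaftRel {k : Type*} [Field k] (m n : ℕ) (q q' σ α : k) :
    FreeAlgebra k TwoTaftGen → FreeAlgebra k TwoTaftGen → Prop
  | h_pow : TwoTaftRel m n q q' σ α (ι k .h ^ m) 1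
  | H_pow : TwoTaftRel m n q q' σ α (ι k .H ^ n) 1
  | x_pow : TwoTaftRel m n q q' σ α (ι k .x ^ m) 0
  | X_pow : TwoTaftRel m n q q' σ α (ι k .X ^ n) 0
  | x_mul_h : TwoTaftRel m n q q' σ α (ι k .x * ι k .h) (q • (ι k .h * ι k .x))
  | X_mul_H : TwoTaftRel m n q q' σ α (ι k .X * ι k .H) (q' • (ι k .H * ι k .X))
  | x_mul_H : TwoTaftRel m n q q' σ α (ι k .x * ι k .H) (σ • (ι k .H * ι k .x))
  | h_mul_X : TwoTaftRel m n q q' σ α (ι k .h * ι k .X) (σ • (ι k .X * ι k .h))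
  | x_mul_X : TwoTaftRel m n q q' σ α (ι k .x * ι k .X - σ • (ι k .X * ι k .x))
      (α • (1 - ι k .H * ι k .h))
  | h_mul_H : TwoTaftRel m n q q' σ α (ι k .h * ι k .H) (ι k .H * ι k .h)

/-- The `k`-algebra generated by `h`, `x`, `H`, `X` subject to the relations `TwoTaftRelations`,
where `q` is a primitive `m`-th and `q'` a primitive `n`-th root of unity. It is a Hopf algebra, by
the instance given below, with `h`, `H` group-like, `x` an `(h, 1)`-primitive and `X` an
`(H, 1)`-primitive element. The two families `TaftSigma` and `TaftQ` are special cases. -/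
def TwoTaft {k : Type*} [Field k] {m n : ℕ} {q q' : k} (_hq' : IsPrimitiveRoot q' n)
    (_hq : IsPrimitiveRoot q m) (σ α : k) : Type _ :=
  RingQuot (TwoTaftRel m n q q' σ α)

namespace TwoTaft

variable {k : Type*} [Field k] {m n : ℕ} {q q' : k} (hq' : IsPrimitiveRoot q' n)
  (hq : IsPrimitiveRoot q m) (σ α : k)

instance : Ring (TwoTaft hq' hq σ α) :=
  inferInstanceAs (Ring (RingQuot (TwoTaftRel m n q q' σ α)))

instance : Algebra k (TwoTaft hq' hq σ α) :=
  inferInstanceAs (Algebra k (RingQuot (TwoTaftRel m n q q' σ α)))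

/-- The class of a generator. -/
def gen (g : TwoTaftGen) : TwoTaft hq' hq σ α :=
  RingQuot.mkAlgHom k (TwoTaftRel m n q q' σ α) (FreeAlgebra.ι k g)

/-- The generator `h`. -/
def h : TwoTaft hq' hq σ α := gen hq' hq σ α .h

/-- The generator `x`. -/
def x : TwoTaft hq' hq σ α := gen hq' hq σ α .x

/-- The generator `H`. -/
def H : TwoTaft hq' hq σ α := gen hq' hq σ α .H

/-- The generator `X`. -/
def X : TwoTaft hq' hq σ α := gen hq' hq σ α .X

theorem relations : TwoTaftRelations m n q q' σ α (h hq' hq σ α) (x hq' hq σ α) (H hq' hq σ α)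
    (X hq' hq σ α) where
  h_pow := by
    have := RingQuot.mkAlgHom_rel k (TwoTaftRel.h_pow (m := m) (n := n) (q := q) (q' := q')
      (σ := σ) (α := α))
    simp only [map_pow, map_one] at this
    exact this
  H_pow := by
    have := RingQuot.mkAlgHom_rel k (TwoTaftRel.H_pow (m := m) (n := n) (q := q) (q' := q')
      (σ := σ) (α := α))
    simp only [map_pow, map_one] at this
    exact this
  x_pow := by
    have := RingQuot.mkAlgHom_rel k (TwoTaftRel.x_pow (m := m) (n := n) (q := q) (q' := q')
      (σ := σ) (α := α))
    simp only [map_pow, map_zero] at this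
    exact this
  X_pow := by
    have := RingQuot.mkAlgHom_rel k (TwoTaftRel.X_pow (m := m) (n := n) (q := q) (q' := q')
      (σ := σ) (α := α))
    simp only [map_pow, map_zero] at this
    exact this
  x_mul_h := by
    have := RingQuot.mkAlgHom_rel k (TwoTaftRel.x_mul_h (m := m) (n := n) (q := q) (q' := q')
      (σ := σ) (α := α))
    simp only [map_smul, map_mul] at this
    exact this
  X_mul_H := by
    have := RingQuot.mkAlgHom_rel k (TwoTaftRel.X_mul_H (m := m) (n := n) (q := q) (q' := q')
      (σ := σ) (α := α))
    simp only [map_smul, map_mul] at this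
    exact this
  x_mul_H := by
    have := RingQuot.mkAlgHom_rel k (TwoTaftRel.x_mul_H (m := m) (n := n) (q := q) (q' := q')
      (σ := σ) (α := α))
    simp only [map_smul, map_mul] at this
    exact this
  h_mul_X := by
    have := RingQuot.mkAlgHom_rel k (TwoTaftRel.h_mul_X (m := m) (n := n) (q := q) (q' := q')
      (σ := σ) (α := α))
    simp only [map_smul, map_mul] at this
    exact this
  x_mul_X := by
    have := RingQuot.mkAlgHom_rel k (TwoTaftRel.x_mul_X (m := m) (n := n) (q := q) (q' := q')
      (σ := σ) (α := α))
    simp only [map_smul, map_mul, map_sub, map_one] at this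
    exact this
  h_mul_H := by
    have := RingQuot.mkAlgHom_rel k (TwoTaftRel.h_mul_H (m := m) (n := n) (q := q) (q' := q')
      (σ := σ) (α := α))
    simp only [map_mul] at this
    exact this

/-- The universal property of the presentation. -/
def lift {B : Type*} [Ring B] [Algebra k B] {a b c d : B}
    (w : TwoTaftRelations m n q q' σ α a b c d) : TwoTaft hq' hq σ α →ₐ[k] B :=
  RingQuot.liftAlgHom k ⟨FreeAlgebra.lift k (fun g => TwoTaftGen.casesOn g a b c d), by
    intro u v huv
    cases huv
    · simpa using w.h_pow
    · simpa using w.H_pow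
    · simpa using w.x_pow
    · simpa using w.X_pow
    · simpa using w.x_mul_h
    · simpa using w.X_mul_H
    · simpa using w.x_mul_H
    · simpa using w.h_mul_X
    · simpa using w.x_mul_X
    · simpa using w.h_mul_H⟩

section lift

variable {B : Type*} [Ring B] [Algebra k B] {a b c d : B}
  (w : TwoTaftRelations m n q q' σ α a b c d)

@[simp]
theorem lift_h : lift hq' hq σ α w (h hq' hq σ α) = a :=
  (RingQuot.liftAlgHom_mkAlgHom_apply _ _ _ _).trans (by simp)

@[simp]
theorem lift_x : lift hq' hq σ α w (x hq' hq σ α) = b :=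
  (RingQuot.liftAlgHom_mkAlgHom_apply _ _ _ _).trans (by simp)

@[simp]
theorem lift_H : lift hq' hq σ α w (H hq' hq σ α) = c :=
  (RingQuot.liftAlgHom_mkAlgHom_apply _ _ _ _).trans (by simp)

@[simp]
theorem lift_X : lift hq' hq σ α w (X hq' hq σ α) = d :=
  (RingQuot.liftAlgHom_mkAlgHom_apply _ _ _ _).trans (by simp)

end lift

theorem adjoin_gen : Algebra.adjoin k (Set.range (gen hq' hq σ α)) = ⊤ :=
  adjoin_ringQuot (TwoTaftRel m n q q' σ α)

theorem algHom_ext {B : Type*} [Semiring B] [Algebra k B] {f g : TwoTaft hq' hq σ α →ₐ[k] B}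
    (hh : f (h hq' hq σ α) = g (h hq' hq σ α)) (hx : f (x hq' hq σ α) = g (x hq' hq σ α))
    (hH : f (H hq' hq σ α) = g (H hq' hq σ α)) (hX : f (X hq' hq σ α) = g (X hq' hq σ α)) :
    f = g := by
  refine AlgHom.ext_of_adjoin_eq_top (adjoin_gen hq' hq σ α) ?_
  rintro _ ⟨_ | _ | _ | _, rfl⟩
  exacts [hh, hx, hH, hX]

/-- The relations are compatible with the comultiplication. -/
theorem _root_.TaftBicrossed.TwoTaftRelations.comul {k B : Type*} [Field k] [Ring B] [Algebra k B]
    {m n : ℕ} {q q' σ α : k} (hq' : IsPrimitiveRoot q' n) (hq : IsPrimitiveRoot q m)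
    {h x H X : B} (w : TwoTaftRelations m n q q' σ α h x H X) :
    TwoTaftRelations m n q q' σ α (h ⊗ₜ[k] h) (x ⊗ₜ[k] h + 1 ⊗ₜ[k] x) (H ⊗ₜ[k] H)
      (X ⊗ₜ[k] H + 1 ⊗ₜ[k] X) where
  h_pow := by rw [Algebra.TensorProduct.tmul_pow, w.h_pow, Algebra.TensorProduct.one_def]
  H_pow := by rw [Algebra.TensorProduct.tmul_pow, w.H_pow, Algebra.TensorProduct.one_def]
  x_pow := add_pow_eq_zero_of_qcomm hq
    (by simp [Algebra.TensorProduct.tmul_mul_tmul, w.x_mul_h])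
    (by simp [Algebra.TensorProduct.tmul_pow, w.x_pow])
    (by simp [Algebra.TensorProduct.tmul_pow, w.x_pow])
  X_pow := add_pow_eq_zero_of_qcomm hq'
    (by simp [Algebra.TensorProduct.tmul_mul_tmul, w.X_mul_H])
    (by simp [Algebra.TensorProduct.tmul_pow, w.X_pow])
    (by simp [Algebra.TensorProduct.tmul_pow, w.X_pow])
  x_mul_h := by
    simp [Algebra.TensorProduct.tmul_mul_tmul, w.x_mul_h, add_mul, mul_add,
      TensorProduct.smul_tmul']
  X_mul_H := by
    simp [Algebra.TensorProduct.tmul_mul_tmul, w.X_mul_H, add_mul, mul_add,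
      TensorProduct.smul_tmul']
  x_mul_H := by
    simp [Algebra.TensorProduct.tmul_mul_tmul, w.x_mul_H, w.h_mul_H, add_mul, mul_add,
      TensorProduct.smul_tmul']
  h_mul_X := by
    simp [Algebra.TensorProduct.tmul_mul_tmul, w.h_mul_X, w.h_mul_H, add_mul, mul_add,
      TensorProduct.smul_tmul']
  x_mul_X := by
    have e : x * X = σ • (X * x) + α • (1 - H * h) := by rw [← w.x_mul_X]; abel
    simp only [Algebra.TensorProduct.tmul_mul_tmul, add_mul, mul_add, one_mul, mul_one, e,
      w.h_mul_H, w.h_mul_X, w.x_mul_H, Algebra.TensorProduct.one_def, TensorProduct.add_tmul,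
      TensorProduct.tmul_add, TensorProduct.tmul_smul, TensorProduct.sub_tmul,
      TensorProduct.tmul_sub, ← TensorProduct.smul_tmul', smul_sub, smul_add]
    abel
  h_mul_H := by simp [Algebra.TensorProduct.tmul_mul_tmul, w.h_mul_H]

/-- The comultiplication: `Δ h = h ⊗ h`, `Δ x = x ⊗ h + 1 ⊗ x`, `Δ H = H ⊗ H`,
`Δ X = X ⊗ H + 1 ⊗ X`. -/
def comulHom : TwoTaft hq' hq σ α →ₐ[k] TwoTaft hq' hq σ α ⊗[k] TwoTaft hq' hq σ α :=
  lift hq' hq σ α ((relations hq' hq σ α).comul hq' hq)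

variable [NeZero m] [NeZero n]

theorem relations_counit : TwoTaftRelations m n q q' σ α (1 : k) 0 1 0 where
  h_pow := one_pow m
  H_pow := one_pow n
  x_pow := zero_pow (NeZero.ne m)
  X_pow := zero_pow (NeZero.ne n)
  x_mul_h := by simp
  X_mul_H := by simp
  x_mul_H := by simp
  h_mul_X := by simp
  x_mul_X := by simp
  h_mul_H := by simp

/-- The counit: `ε h = ε H = 1` and `ε x = ε X = 0`. -/
def counitHom : TwoTaft hq' hq σ α →ₐ[k] k :=
  lift hq' hq σ α (relations_counit σ α)

instance : Bialgebra k (TwoTaft hq' hq σ α) :=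
  Bialgebra.ofAlgHom (comulHom hq' hq σ α) (counitHom hq' hq σ α)
    (by apply algHom_ext <;>
      simp [comulHom, TensorProduct.add_tmul, TensorProduct.tmul_add,
        Algebra.TensorProduct.one_def, add_assoc])
    (by apply algHom_ext <;> simp [comulHom, counitHom])
    (by apply algHom_ext <;> simp [comulHom, counitHom])

theorem comul_h : Coalgebra.comul (R := k) (h hq' hq σ α) = h hq' hq σ α ⊗ₜ h hq' hq σ α :=
  lift_h hq' hq σ α _

theorem comul_x : Coalgebra.comul (R := k) (x hq' hq σ α) =
    x hq' hq σ α ⊗ₜ h hq' hq σ α + 1 ⊗ₜ x hq' hq σ α :=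
  lift_x hq' hq σ α _

theorem comul_H : Coalgebra.comul (R := k) (H hq' hq σ α) = H hq' hq σ α ⊗ₜ H hq' hq σ α :=
  lift_H hq' hq σ α _

theorem comul_X : Coalgebra.comul (R := k) (X hq' hq σ α) =
    X hq' hq σ α ⊗ₜ H hq' hq σ α + 1 ⊗ₜ X hq' hq σ α :=
  lift_X hq' hq σ α _

theorem counit_h : Coalgebra.counit (R := k) (h hq' hq σ α) = 1 := lift_h hq' hq σ α _

theorem counit_x : Coalgebra.counit (R := k) (x hq' hq σ α) = 0 := lift_x hq' hq σ α _

theorem counit_H : Coalgebra.counit (R := k) (H hq' hq σ α) = 1 := lift_H hq' hq σ α _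

theorem counit_X : Coalgebra.counit (R := k) (X hq' hq σ α) = 0 := lift_X hq' hq σ α _

/-- If `g ^ m = 1` then `g * g ^ (m - 1) = 1`. -/
theorem mul_pow_pred {B : Type*} [Ring B] {m : ℕ} [NeZero m] {g : B} (hg : g ^ m = 1) :
    g * g ^ (m - 1) = 1 := by
  rw [← pow_succ', Nat.sub_add_cancel (NeZero.one_le), hg]

/-- If `g ^ m = 1` then `g ^ (m - 1) * g = 1`. -/
theorem pow_pred_mul {B : Type*} [Ring B] {m : ℕ} [NeZero m] {g : B} (hg : g ^ m = 1) :
    g ^ (m - 1) * g = 1 := by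
  rw [← pow_succ, Nat.sub_add_cancel (NeZero.one_le), hg]

/-- If `y g = c g y` and `g ^ m = 1` then `g⁻¹ y = c y g⁻¹`. -/
theorem inv_mul_of_qcomm {k B : Type*} [Field k] [Ring B] [Algebra k B] {m : ℕ} [NeZero m]
    {c : k} {g y : B} (hg : g ^ m = 1) (hy : y * g = c • (g * y)) :
    g ^ (m - 1) * y = c • (y * g ^ (m - 1)) := by
  calc g ^ (m - 1) * y = g ^ (m - 1) * (y * g) * g ^ (m - 1) := by
        rw [mul_assoc, mul_assoc, mul_pow_pred hg, mul_one]
    _ = c • (y * g ^ (m - 1)) := by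
        rw [hy, mul_smul_comm, ← mul_assoc, pow_pred_mul hg, one_mul, smul_mul_assoc]

/-- If `g y = c y g` and `g ^ m = 1` then `y g⁻¹ = c g⁻¹ y`. -/
theorem mul_inv_of_qcomm {k B : Type*} [Field k] [Ring B] [Algebra k B] {m : ℕ} [NeZero m]
    {c : k} {g y : B} (hg : g ^ m = 1) (hy : g * y = c • (y * g)) :
    y * g ^ (m - 1) = c • (g ^ (m - 1) * y) := by
  calc y * g ^ (m - 1) = g ^ (m - 1) * (g * y) * g ^ (m - 1) := by
        rw [← mul_assoc, pow_pred_mul hg, one_mul]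
    _ = c • (g ^ (m - 1) * y) := by
        rw [hy, mul_smul_comm, smul_mul_assoc, mul_assoc, mul_assoc, mul_pow_pred hg, mul_one]

open MulOpposite in
/-- The relations are compatible with the antipode. -/
theorem _root_.TaftBicrossed.TwoTaftRelations.antipode {k B : Type*} [Field k] [Ring B]
    [Algebra k B] {m n : ℕ} [NeZero m] [NeZero n] {q q' σ α : k}
    {h x H X : B} (w : TwoTaftRelations m n q q' σ α h x H X) :
    TwoTaftRelations m n q q' σ α (op (h ^ (m - 1))) (op (-(x * h ^ (m - 1))))
      (op (H ^ (n - 1))) (op (-(X * H ^ (n - 1)))) where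
  h_pow := by rw [← op_pow, ← pow_mul, mul_comm, pow_mul, w.h_pow, one_pow, op_one]
  H_pow := by rw [← op_pow, ← pow_mul, mul_comm, pow_mul, w.H_pow, one_pow, op_one]
  x_pow := by
    rw [← op_pow, neg_pow, mul_pow_eq_zero_of_qcomm (inv_mul_of_qcomm w.h_pow w.x_mul_h) w.x_pow,
      mul_zero, op_zero]
  X_pow := by
    rw [← op_pow, neg_pow, mul_pow_eq_zero_of_qcomm (inv_mul_of_qcomm w.H_pow w.X_mul_H) w.X_pow,
      mul_zero, op_zero]
  x_mul_h := by
    rw [← op_mul, ← op_mul, ← op_smul, mul_neg, neg_mul, ← mul_assoc,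
      inv_mul_of_qcomm w.h_pow w.x_mul_h, smul_neg, smul_mul_assoc]
  X_mul_H := by
    rw [← op_mul, ← op_mul, ← op_smul, mul_neg, neg_mul, ← mul_assoc,
      inv_mul_of_qcomm w.H_pow w.X_mul_H, smul_neg, smul_mul_assoc]
  x_mul_H := by
    have hc : H ^ (n - 1) * h ^ (m - 1) = h ^ (m - 1) * H ^ (n - 1) :=
      ((show Commute h H from w.h_mul_H).symm.pow_pow _ _)
    rw [← op_mul, ← op_mul, ← op_smul, mul_neg, neg_mul, ← mul_assoc,
      inv_mul_of_qcomm w.H_pow w.x_mul_H, smul_neg, smul_mul_assoc, mul_assoc, mul_assoc, hc]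
  h_mul_X := by
    have hc : H ^ (n - 1) * h ^ (m - 1) = h ^ (m - 1) * H ^ (n - 1) :=
      ((show Commute h H from w.h_mul_H).symm.pow_pow _ _)
    rw [← op_mul, ← op_mul, ← op_smul, mul_neg, neg_mul, mul_assoc, hc, ← mul_assoc, ← mul_assoc,
      mul_inv_of_qcomm w.h_pow w.h_mul_X, smul_neg, smul_mul_assoc]
  x_mul_X := by
    have hc : H ^ (n - 1) * h ^ (m - 1) = h ^ (m - 1) * H ^ (n - 1) :=
      ((show Commute h H from w.h_mul_H).symm.pow_pow _ _)
    have e1 : X * H ^ (n - 1) * (x * h ^ (m - 1)) =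
        σ • (X * x) * (h ^ (m - 1) * H ^ (n - 1)) := by
      rw [mul_assoc, ← mul_assoc (H ^ (n - 1)), inv_mul_of_qcomm w.H_pow w.x_mul_H,
        smul_mul_assoc, mul_smul_comm, mul_assoc x, hc, smul_mul_assoc, mul_assoc]
    have e2 : σ • (x * h ^ (m - 1) * (X * H ^ (n - 1))) =
        x * X * (h ^ (m - 1) * H ^ (n - 1)) := by
      rw [mul_assoc, ← mul_assoc (h ^ (m - 1)), ← mul_smul_comm, ← smul_mul_assoc,
        ← mul_inv_of_qcomm w.h_pow w.h_mul_X]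
      simp only [mul_assoc]
    have e3 : H * h * (h ^ (m - 1) * H ^ (n - 1)) = 1 := by
      rw [mul_assoc, ← mul_assoc h, mul_pow_pred w.h_pow, one_mul, mul_pow_pred w.H_pow]
    rw [← op_mul, ← op_mul, ← op_mul, ← op_smul, ← op_sub, ← op_one, ← op_sub, ← op_smul,
      neg_mul_neg, neg_mul_neg, e1, e2, ← sub_mul, ← neg_sub, w.x_mul_X, ← smul_neg, neg_sub,
      smul_mul_assoc, sub_mul, e3, one_mul]
  h_mul_H := by
    have hc : H ^ (n - 1) * h ^ (m - 1) = h ^ (m - 1) * H ^ (n - 1) :=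
      ((show Commute h H from w.h_mul_H).symm.pow_pow _ _)
    rw [← op_mul, ← op_mul, hc]

/-- The antipode as a homomorphism to the opposite algebra: `S h = h⁻¹`, `S x = - x h⁻¹`,
`S H = H⁻¹`, `S X = - X H⁻¹`. -/
def antipodeHom : TwoTaft hq' hq σ α →ₐ[k] (TwoTaft hq' hq σ α)ᵐᵒᵖ :=
  lift hq' hq σ α (relations hq' hq σ α).antipode

theorem antipode_left_gen (g : TwoTaftGen) :
    LinearMap.mul' k _ (LinearMap.rTensor _
      ((MulOpposite.opLinearEquiv k).symm.toLinearMap ∘ₗ (antipodeHom hq' hq σ α).toLinearMap)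
      (Coalgebra.comul (gen hq' hq σ α g))) =
      algebraMap k _ (Coalgebra.counit (gen hq' hq σ α g)) := by
  have w := relations hq' hq σ α
  cases g
  · refine (congrArg _ (congrArg _ (comul_h hq' hq σ α))).trans
      (Eq.trans ?_ (congrArg _ (counit_h hq' hq σ α)).symm)
    simp [antipodeHom, pow_pred_mul w.h_pow]
  · refine (congrArg _ (congrArg _ (comul_x hq' hq σ α))).trans
      (Eq.trans ?_ (congrArg _ (counit_x hq' hq σ α)).symm)
    simp [antipodeHom, pow_pred_mul w.h_pow, mul_assoc]
  · refine (congrArg _ (congrArg _ (comul_H hq' hq σ α))).trans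
      (Eq.trans ?_ (congrArg _ (counit_H hq' hq σ α)).symm)
    simp [antipodeHom, pow_pred_mul w.H_pow]
  · refine (congrArg _ (congrArg _ (comul_X hq' hq σ α))).trans
      (Eq.trans ?_ (congrArg _ (counit_X hq' hq σ α)).symm)
    simp [antipodeHom, pow_pred_mul w.H_pow, mul_assoc]

theorem antipode_right_gen (g : TwoTaftGen) :
    LinearMap.mul' k _ (LinearMap.lTensor _
      ((MulOpposite.opLinearEquiv k).symm.toLinearMap ∘ₗ (antipodeHom hq' hq σ α).toLinearMap)
      (Coalgebra.comul (gen hq' hq σ α g))) =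
      algebraMap k _ (Coalgebra.counit (gen hq' hq σ α g)) := by
  have w := relations hq' hq σ α
  cases g
  · refine (congrArg _ (congrArg _ (comul_h hq' hq σ α))).trans
      (Eq.trans ?_ (congrArg _ (counit_h hq' hq σ α)).symm)
    simp [antipodeHom, mul_pow_pred w.h_pow]
  · refine (congrArg _ (congrArg _ (comul_x hq' hq σ α))).trans
      (Eq.trans ?_ (congrArg _ (counit_x hq' hq σ α)).symm)
    simp [antipodeHom]
  · refine (congrArg _ (congrArg _ (comul_H hq' hq σ α))).trans
      (Eq.trans ?_ (congrArg _ (counit_H hq' hq σ α)).symm)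
    simp [antipodeHom, mul_pow_pred w.H_pow]
  · refine (congrArg _ (congrArg _ (comul_X hq' hq σ α))).trans
      (Eq.trans ?_ (congrArg _ (counit_X hq' hq σ α)).symm)
    simp [antipodeHom]

instance : HopfAlgebra k (TwoTaft hq' hq σ α) where
  antipode := (MulOpposite.opLinearEquiv k).symm.toLinearMap ∘ₗ
    (antipodeHom hq' hq σ α).toLinearMap
  mul_antipode_rTensor_comul := by
    refine antipode_left_of_adjoin _ (by simp) (by simp) (adjoin_gen hq' hq σ α) ?_
    rintro _ ⟨g, rfl⟩
    exact antipode_left_gen hq' hq σ α g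
  mul_antipode_lTensor_comul := by
    refine antipode_right_of_adjoin _ (by simp) (by simp) (adjoin_gen hq' hq σ α) ?_
    rintro _ ⟨g, rfl⟩
    exact antipode_right_gen hq' hq σ α g

/-- If `y g = c g y`, `g ^ m = 1` and `c ^ m = 1` then `y g⁻¹ = c⁻¹ g⁻¹ y`. -/
theorem mul_inv_eq_smul {k B : Type*} [Field k] [Ring B] [Algebra k B] {m : ℕ} [NeZero m]
    {c : k} {g y : B} (hc : c ^ m = 1) (hg : g ^ m = 1) (hy : y * g = c • (g * y)) :
    y * g ^ (m - 1) = c ^ (m - 1) • (g ^ (m - 1) * y) := by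
  rw [inv_mul_of_qcomm hg hy, smul_smul, ← pow_succ, Nat.sub_add_cancel (NeZero.one_le), hc,
    one_smul]

theorem antipode_h : HopfAlgebra.antipode k (h hq' hq σ α) = h hq' hq σ α ^ (m - 1) := by
  change MulOpposite.unop (antipodeHom hq' hq σ α (h hq' hq σ α)) = _
  simp [antipodeHom]

theorem antipode_H : HopfAlgebra.antipode k (H hq' hq σ α) = H hq' hq σ α ^ (n - 1) := by
  change MulOpposite.unop (antipodeHom hq' hq σ α (H hq' hq σ α)) = _
  simp [antipodeHom]

theorem antipode_x : HopfAlgebra.antipode k (x hq' hq σ α) =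
    -(q ^ (m - 1) • (h hq' hq σ α ^ (m - 1) * x hq' hq σ α)) := by
  have w := relations hq' hq σ α
  rw [← mul_inv_eq_smul hq.pow_eq_one w.h_pow w.x_mul_h]
  change MulOpposite.unop (antipodeHom hq' hq σ α (x hq' hq σ α)) = _
  simp [antipodeHom]

theorem antipode_X : HopfAlgebra.antipode k (X hq' hq σ α) =
    -(q' ^ (n - 1) • (H hq' hq σ α ^ (n - 1) * X hq' hq σ α)) := by
  have w := relations hq' hq σ α
  rw [← mul_inv_eq_smul hq'.pow_eq_one w.H_pow w.X_mul_H]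
  change MulOpposite.unop (antipodeHom hq' hq σ α (X hq' hq σ α)) = _
  simp [antipodeHom]

end TwoTaft

/-- The Hopf algebra `T^σ_{n,m}(q', q)`: the case `α = 0`, with relations
`h ^ m = H ^ n = 1`, `x ^ m = X ^ n = 0`, `x h = q h x`, `X H = q' H X`,
`x H = σ H x`, `h X = σ X h`, `x X = σ X x`, `h H = H h`. -/
abbrev TaftSigma {k : Type*} [Field k] {m n : ℕ} {q q' : k} (hq' : IsPrimitiveRoot q' n)
    (hq : IsPrimitiveRoot q m) (σ : k) : Type _ :=
  TwoTaft hq' hq σ 0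

theorem isPrimitiveRoot_pow_pred {k : Type*} [Field k] {n : ℕ} [NeZero n] {q : k}
    (hq : IsPrimitiveRoot q n) : IsPrimitiveRoot (q ^ (n - 1)) n :=
  hq.pow_of_coprime _ ((Nat.coprime_self_sub_left NeZero.one_le).2 (Nat.coprime_one_left n))

/-- The Hopf algebra `Q^α_n(q)`: the case `m = n`, `q' = q ^ (n - 1)`, `σ = q`, with relations
`h ^ n = H ^ n = 1`, `x ^ n = X ^ n = 0`, `x h = q h x`, `X H = q ^ (n - 1) H X`,
`x H = q H x`, `h X = q X h`, `x X - q X x = α (1 - H h)`, `h H = H h`. -/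
abbrev TaftQ {k : Type*} [Field k] {n : ℕ} [NeZero n] {q : k} (hq : IsPrimitiveRoot q n)
    (α : k) : Type _ :=
  TwoTaft (isPrimitiveRoot_pow_pred hq) hq q α

end TwoTaft

/-- A Hopf algebra `E` factors through the Hopf algebras `A` and `L` if there are injective Hopf
algebra maps `i : A → E` and `j : L → E` such that `A ⊗ L → E`, `a ⊗ l ↦ i a * j l`, is bijective.
(A bialgebra map between Hopf algebras automatically commutes with the antipodes.) -/
def FactorsThrough (k A L E : Type*) [Field k] [Ring A] [HopfAlgebra k A] [Ring L]
    [HopfAlgebra k L] [Ring E] [HopfAlgebra k E] : Prop :=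
  ∃ (i : A →ₐc[k] E) (j : L →ₐc[k] E), Function.Injective i ∧ Function.Injective j ∧
    Function.Bijective (LinearMap.mul' k E ∘ₗ
      TensorProduct.map (i : A →ₗ[k] E) (j : L →ₗ[k] E))

end TaftBicrossed

end

/-!
Multiplication identifies a Hopf algebra factoring through two Taft algebras, generated by `H`, `X`
and by `h`, `x`, with their tensor product as a coalgebra, so its skew-primitive elements can be
read off there. The functionals dual to `X ⊗ 1` and `1 ⊗ x` act on the tensor product by nilpotent
hit operators; subtracting from a skew-primitive element its `X`- and `x`-components leaves an
element killed by both, and these are combinations of group-likes. Conjugation by group-likes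
permutes skew-primitive elements, which forces `hH = Hh`, `hX = σXh` and `xH = τHx`. The
coproduct of `xX - σXx` then forces `τ = σ` and `xX - σXx = α(1 - Hh)`. Finally `h ^ m = 1 = H ^ n`
gives `σ ^ m = 1 = σ ^ n`, and commuting `xX - σXx` past `h` and `H` leaves only `α = 0`, or `σ = q`
and `q'q = 1`.

Conversely, for such parameters the relations let the free algebra on `h, x, H, X` act on the tensor
product of the two Taft algebras by straightening words, and evaluating this action at `1 ⊗ 1`
inverts the multiplication map.
-/

namespace TaftBicrossed

section QCommute

variable {k B : Type*} [Field k] [Ring B] [Algebra k B]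

theorem adjoin_left_induction {s : Set B} (hs : Algebra.adjoin k s = ⊤) {p : Submodule k B}
    (one_mem : 1 ∈ p) (mul_mem : ∀ a ∈ s, ∀ b ∈ p, a * b ∈ p) (a : B) : a ∈ p := by
  suffices ∀ b ∈ p, a * b ∈ p by simpa using this 1 one_mem
  have ha : a ∈ Algebra.adjoin k s := hs ▸ Algebra.mem_top
  induction ha using Algebra.adjoin_induction with
  | mem a ha => exact mul_mem a ha
  | algebraMap r =>
    intro b hb
    rw [← Algebra.smul_def]
    exact p.smul_mem r hb
  | add a₁ a₂ _ _ h₁ h₂ =>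
    intro b hb
    rw [add_mul]
    exact p.add_mem (h₁ b hb) (h₂ b hb)
  | mul a₁ a₂ _ _ h₁ h₂ =>
    intro b hb
    rw [mul_assoc]
    exact h₁ _ (h₂ b hb)

theorem pow_mul_of_qcomm {c : k} {y z : B} (hyz : y * z = c • (z * y)) (i : ℕ) :
    y ^ i * z = c ^ i • (z * y ^ i) := by
  induction i with
  | zero => simp
  | succ i ih =>
    rw [pow_succ, mul_assoc, hyz, mul_smul_comm, ← mul_assoc, ih, smul_mul_assoc, smul_smul,
      mul_assoc, pow_succ']

theorem pow_mul_eq_smul_add_sum (s : k) (y z : B) (m : ℕ) :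
    y ^ m * z = s ^ m • (z * y ^ m) +
      ∑ i ∈ Finset.range m, s ^ i • (y ^ (m - 1 - i) * (y * z - s • (z * y)) * y ^ i) := by
  have telescope : ∀ i ∈ Finset.range m,
      s ^ i • (y ^ (m - 1 - i) * (y * z - s • (z * y)) * y ^ i) =
        s ^ i • (y ^ (m - i) * z * y ^ i) -
          s ^ (i + 1) • (y ^ (m - (i + 1)) * z * y ^ (i + 1)) := by
    intro i hi
    obtain ⟨j, rfl⟩ : ∃ j, m = j + i + 1 := ⟨m - 1 - i, by have := Finset.mem_range.1 hi; omega⟩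
    rw [show j + i + 1 - 1 - i = j by omega, show j + i + 1 - i = j + 1 by omega,
      show j + i + 1 - (i + 1) = j by omega]
    simp only [mul_sub, sub_mul, smul_sub, mul_smul_comm, smul_mul_assoc, smul_smul, pow_succ,
      mul_assoc]
    rw [← pow_succ, pow_mul_comm']
  rw [Finset.sum_congr rfl telescope, Finset.sum_range_sub']
  simp

theorem sum_pow_mul_mul_pow_eq_zero {s c : k} {y r : B} {m : ℕ} (hs : s ^ m = c ^ m) (hsc : s ≠ c)
    (hr : y * r = c • (r * y)) :
    ∑ i ∈ Finset.range m, s ^ i • (y ^ (m - 1 - i) * r * y ^ i) = 0 := by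
  have collect : ∀ i ∈ Finset.range m, s ^ i • (y ^ (m - 1 - i) * r * y ^ i) =
      (s ^ i * c ^ (m - 1 - i)) • (r * y ^ (m - 1)) := by
    intro i hi
    have hi : m - 1 - i + i = m - 1 := by have := Finset.mem_range.1 hi; omega
    rw [pow_mul_of_qcomm hr, smul_mul_assoc, smul_smul, mul_assoc, ← pow_add, hi]
  have geom : ∑ i ∈ Finset.range m, s ^ i * c ^ (m - 1 - i) = 0 := by
    have := geom_sum₂_mul s c m
    rw [hs, sub_self] at this
    exact (mul_eq_zero.1 this).resolve_right (sub_ne_zero.2 hsc)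
  rw [Finset.sum_congr rfl collect, ← Finset.sum_smul, geom, zero_smul]

end QCommute

namespace Taft

variable {k : Type*} [Field k] {m : ℕ} {q : k} (hq : IsPrimitiveRoot q m)

theorem left_induction {p : Submodule k (Taft hq)} (one_mem : 1 ∈ p)
    (h_mul_mem : ∀ a ∈ p, h hq * a ∈ p) (x_mul_mem : ∀ a ∈ p, x hq * a ∈ p) (a : Taft hq) :
    a ∈ p := by
  refine adjoin_left_induction (adjoin_gen hq) one_mem ?_ a
  rintro _ ⟨_ | _, rfl⟩
  exacts [h_mul_mem, x_mul_mem]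

theorem linearMap_ext {V : Type*} [AddCommGroup V] [Module k V] {f g : Taft hq →ₗ[k] V}
    (one : f 1 = g 1) (h_mul : ∀ a, f a = g a → f (h hq * a) = g (h hq * a))
    (x_mul : ∀ a, f a = g a → f (x hq * a) = g (x hq * a)) : f = g :=
  LinearMap.ext fun a => left_induction hq (p := LinearMap.eqLocus f g) one h_mul x_mul a

theorem span_monomial :
    Submodule.span k (Set.range fun t : ℕ × ℕ => h hq ^ t.1 * x hq ^ t.2) = ⊤ := by
  refine eq_top_iff.2 fun a _ => left_induction hq ?_ ?_ ?_ a
  · exact Submodule.subset_span ⟨(0, 0), by simp⟩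
  · refine fun a ha => (Submodule.map_span_le (LinearMap.mulLeft k (h hq)) _ _).2 ?_
      (Submodule.mem_map_of_mem ha)
    rintro _ ⟨⟨i, j⟩, rfl⟩
    exact Submodule.subset_span ⟨(i + 1, j), by simp [pow_succ', mul_assoc]⟩
  · refine fun a ha => (Submodule.map_span_le (LinearMap.mulLeft k (x hq)) _ _).2 ?_
      (Submodule.mem_map_of_mem ha)
    rintro _ ⟨⟨i, j⟩, rfl⟩
    rw [LinearMap.mulLeft_apply, ← mul_assoc, mul_pow_of_qcomm (x_mul_h hq), smul_mul_assoc,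
      mul_assoc, ← pow_succ']
    exact Submodule.smul_mem _ _ (Submodule.subset_span ⟨(i, j + 1), rfl⟩)

theorem linearMap_ext_monomial {V : Type*} [AddCommGroup V] [Module k V] {f g : Taft hq →ₗ[k] V}
    (hfg : ∀ i j, f (h hq ^ i * x hq ^ j) = g (h hq ^ i * x hq ^ j)) : f = g :=
  LinearMap.ext_on_range (span_monomial hq) fun t => hfg t.1 t.2

end Taft

open Coalgebra

section Hit

variable {R C D : Type*} [CommSemiring R] [AddCommMonoid C] [Module R C] [Coalgebra R C]
  [AddCommMonoid D] [Module R D] [Coalgebra R D]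

/-- The left hit action `f ⇀ c = ∑ f(c₂) c₁` of the dual of a coalgebra on the coalgebra. -/
noncomputable def leftHit : Module.Dual R C →ₗ[R] Module.End R C where
  toFun f := (TensorProduct.rid R C).toLinearMap ∘ₗ f.lTensor C ∘ₗ comul
  map_add' f g := by rw [LinearMap.lTensor_add, LinearMap.add_comp, LinearMap.comp_add]
  map_smul' r f := by
    rw [LinearMap.lTensor_smul, LinearMap.smul_comp, LinearMap.comp_smul, RingHom.id_apply]

/-- The right hit action `c ↼ f = ∑ f(c₁) c₂` of the dual of a coalgebra on the coalgebra. -/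
noncomputable def rightHit : Module.Dual R C →ₗ[R] Module.End R C where
  toFun f := (TensorProduct.lid R C).toLinearMap ∘ₗ f.rTensor C ∘ₗ comul
  map_add' f g := by rw [LinearMap.rTensor_add, LinearMap.add_comp, LinearMap.comp_add]
  map_smul' r f := by
    rw [LinearMap.rTensor_smul, LinearMap.smul_comp, LinearMap.comp_smul, RingHom.id_apply]

theorem leftHit_apply (f : Module.Dual R C) (c : C) :
    leftHit f c = TensorProduct.rid R C (f.lTensor C (comul c)) := rfl

theorem rightHit_apply (f : Module.Dual R C) (c : C) :
    rightHit f c = TensorProduct.lid R C (f.rTensor C (comul c)) := rfl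

theorem leftHit_counit : leftHit (counit : C →ₗ[R] R) = LinearMap.id := by
  ext c
  simp [leftHit_apply]

theorem leftHit_of_isGroupLikeElem (f : Module.Dual R C) {g : C} (hg : IsGroupLikeElem R g) :
    leftHit f g = f g • g := by
  simp [leftHit_apply, hg.comul_eq_tmul_self]

theorem rightHit_of_isGroupLikeElem (f : Module.Dual R C) {g : C} (hg : IsGroupLikeElem R g) :
    rightHit f g = f g • g := by
  simp [rightHit_apply, hg.comul_eq_tmul_self]

theorem leftHit_eq_rightHit_of_mem_span {c : C}
    (hc : c ∈ Submodule.span R {g : C | IsGroupLikeElem R g}) (f : Module.Dual R C) :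
    leftHit f c = rightHit f c := by
  refine (Submodule.span_le (p := LinearMap.eqLocus (leftHit f) (rightHit f))).2 ?_ hc
  intro g hg
  exact (leftHit_of_isGroupLikeElem f hg).trans (rightHit_of_isGroupLikeElem f hg).symm

theorem apply_eq_zero_of_isNilpotent_leftHit {k C : Type*} [Field k] [AddCommGroup C] [Module k C]
    [Coalgebra k C] {f : Module.Dual k C} (hf : IsNilpotent (leftHit f)) {g : C}
    (hg : IsGroupLikeElem k g) : f g = 0 := by
  obtain ⟨N, hN⟩ := hf
  have eigen : Module.End.HasEigenvector (leftHit f) (f g) g :=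
    Module.End.hasEigenvector_iff.2
      ⟨Module.End.mem_eigenspace_iff.2 (leftHit_of_isGroupLikeElem f hg), hg.ne_zero⟩
  have := eigen.pow_apply N
  rw [hN, LinearMap.zero_apply] at this
  exact eq_zero_of_pow_eq_zero ((smul_eq_zero.1 this.symm).resolve_right hg.ne_zero)

theorem leftHit_dualDistrib (f : Module.Dual R C) (g : Module.Dual R D) :
    leftHit (TensorProduct.dualDistrib R C D (f ⊗ₜ g)) =
      TensorProduct.map (leftHit f) (leftHit g) := by
  ext c d
  simp only [TensorProduct.AlgebraTensorModule.curry_apply, LinearMap.restrictScalars_self,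
    TensorProduct.curry_apply, TensorProduct.map_tmul, leftHit_apply, TensorProduct.comul_tmul]
  induction comul (R := R) c using TensorProduct.induction_on with
  | zero => simp
  | add s t hs ht => simp only [TensorProduct.add_tmul, map_add, hs, ht]
  | tmul c₁ c₂ =>
    induction comul (R := R) d using TensorProduct.induction_on with
    | zero => simp
    | add s t hs ht => simp only [TensorProduct.tmul_add, map_add, hs, ht]
    | tmul d₁ d₂ => simp [TensorProduct.smul_tmul', TensorProduct.tmul_smul, smul_smul, mul_comm]

end Hit

section SkewPrimitive

variable {R A B : Type*} [CommSemiring R] [Semiring A] [Bialgebra R A] [Semiring B] [Bialgebra R B]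

variable (R) in
/-- The element `y` is `(g, 1)`-primitive: `Δ y = y ⊗ g + 1 ⊗ y`. -/
def IsSkewPrimitive (g y : A) : Prop :=
  comul (R := R) y = y ⊗ₜ g + 1 ⊗ₜ y

namespace IsSkewPrimitive

variable {g y : A}

theorem comul_eq (hy : IsSkewPrimitive R g y) : comul (R := R) y = y ⊗ₜ g + 1 ⊗ₜ y := hy

theorem map {F : Type*} [FunLike F A B] [CoalgHomClass F R A B] (hy : IsSkewPrimitive R g y) (f : F)
    (hf : f 1 = 1) : IsSkewPrimitive R (f g) (f y) := by
  rw [IsSkewPrimitive, ← CoalgHomClass.map_comp_comul_apply, hy.comul_eq]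
  simp [hf]

theorem leftHit_eq (hy : IsSkewPrimitive R g y) (f : Module.Dual R A) :
    leftHit f y = f g • y + f y • 1 := by
  simp [leftHit_apply, hy.comul_eq]

theorem rightHit_eq (hy : IsSkewPrimitive R g y) (f : Module.Dual R A) :
    rightHit f y = f y • g + f 1 • y := by
  simp [rightHit_apply, hy.comul_eq]

end IsSkewPrimitive

section HitMul

variable (f : Module.Dual R A) {g y : A}

theorem leftHit_groupLike_mul (hg : IsGroupLikeElem R g) (a : A) :
    leftHit f (g * a) = g * leftHit (f ∘ₗ LinearMap.mulLeft R g) a := by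
  simp only [leftHit_apply, Bialgebra.comul_mul, hg.comul_eq_tmul_self]
  induction comul (R := R) a using TensorProduct.induction_on with
  | zero => simp
  | add s t hs ht => simp only [mul_add, map_add, hs, ht]
  | tmul b c => simp

theorem rightHit_groupLike_mul (hg : IsGroupLikeElem R g) (a : A) :
    rightHit f (g * a) = g * rightHit (f ∘ₗ LinearMap.mulLeft R g) a := by
  simp only [rightHit_apply, Bialgebra.comul_mul, hg.comul_eq_tmul_self]
  induction comul (R := R) a using TensorProduct.induction_on with
  | zero => simp
  | add s t hs ht => simp only [mul_add, map_add, hs, ht]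
  | tmul b c => simp

theorem leftHit_skewPrimitive_mul (hy : IsSkewPrimitive R g y) (a : A) :
    leftHit f (y * a) = y * leftHit (f ∘ₗ LinearMap.mulLeft R g) a +
      leftHit (f ∘ₗ LinearMap.mulLeft R y) a := by
  simp only [leftHit_apply, Bialgebra.comul_mul, hy.comul_eq]
  induction comul (R := R) a using TensorProduct.induction_on with
  | zero => simp
  | add s t hs ht => simp only [mul_add, map_add, hs, ht]; abel
  | tmul b c => simp [add_mul]

theorem rightHit_skewPrimitive_mul (hy : IsSkewPrimitive R g y) (a : A) :
    rightHit f (y * a) = g * rightHit (f ∘ₗ LinearMap.mulLeft R y) a + y * rightHit f a := by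
  simp only [rightHit_apply, Bialgebra.comul_mul, hy.comul_eq]
  induction comul (R := R) a using TensorProduct.induction_on with
  | zero => simp
  | add s t hs ht => simp only [mul_add, map_add, hs, ht]; abel
  | tmul b c => simp [add_mul]

end HitMul

end SkewPrimitive

namespace Taft

variable {k : Type*} [Field k] {m : ℕ} {q : k} (hq : IsPrimitiveRoot q m)

/-- The algebra endomorphism `h ↦ b h`, `x ↦ c x` of the Taft algebra, for `b ^ m = 1`. -/
noncomputable def rescale {b : k} (hb : b ^ m = 1) (c : k) : Taft hq →ₐ[k] Taft hq :=
  lift hq (b • h hq) (c • x hq) (by rw [smul_pow, hb, h_pow, one_smul])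
    (by rw [smul_pow, x_pow, smul_zero])
    (by rw [smul_mul_smul, x_mul_h, smul_mul_smul, smul_comm, mul_comm])

section rescale

variable {b b' : k} (hb : b ^ m = 1) (hb' : b' ^ m = 1) (c c' : k)

@[simp]
theorem rescale_h : rescale hq hb c (h hq) = b • h hq := lift_h hq _ _ _ _ _

@[simp]
theorem rescale_x : rescale hq hb c (x hq) = c • x hq := lift_x hq _ _ _ _ _

theorem rescale_one_one (h1 : (1 : k) ^ m = 1) (a : Taft hq) : rescale hq h1 1 a = a :=
  DFunLike.congr_fun (algHom_ext hq (g := AlgHom.id k _) (by simp) (by simp)) a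

theorem rescale_rescale {d : k} (hd : d ^ m = 1) (hbd : b * b' = d) (a : Taft hq) :
    rescale hq hb c (rescale hq hb' c' a) = rescale hq hd (c * c') a :=
  DFunLike.congr_fun (algHom_ext hq (f := (rescale hq hb c).comp (rescale hq hb' c'))
    (by simp [smul_smul, ← hbd, mul_comm]) (by simp [smul_smul, mul_comm])) a

theorem x_mul (a : Taft hq) : x hq * a = rescale hq hq.pow_eq_one 1 a * x hq := by
  refine LinearMap.congr_fun (f := LinearMap.mulLeft k (x hq))
    (g := LinearMap.mulRight k (x hq) ∘ₗ (rescale hq hq.pow_eq_one 1).toLinearMap)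
    (linearMap_ext hq (by simp) (fun a ha => ?_) fun a ha => ?_) a
  · simp only [LinearMap.mulLeft_apply, LinearMap.comp_apply, AlgHom.toLinearMap_apply,
      LinearMap.mulRight_apply, map_mul, rescale_h] at ha ⊢
    rw [← mul_assoc, x_mul_h, smul_mul_assoc, mul_assoc, ha, smul_mul_assoc, smul_mul_assoc,
      mul_assoc]
  · simp only [LinearMap.mulLeft_apply, LinearMap.comp_apply, AlgHom.toLinearMap_apply,
      LinearMap.mulRight_apply, map_mul, rescale_x, one_smul] at ha ⊢
    rw [ha, ← mul_assoc]

theorem sum_rescale_pow :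
    ∑ l ∈ Finset.range m, (rescale hq (one_pow m) q).toLinearMap ^ l =
      (m : k) • (rescale hq (one_pow m) 0).toLinearMap := by
  refine linearMap_ext_monomial hq fun i j => ?_
  have pow_rescale : ∀ l, ((rescale hq (one_pow m) q).toLinearMap ^ l) (h hq ^ i * x hq ^ j) =
      (q ^ j) ^ l • (h hq ^ i * x hq ^ j) := by
    intro l
    induction l with
    | zero => simp
    | succ l ih =>
      rw [pow_succ', Module.End.mul_apply, ih, map_smul, AlgHom.toLinearMap_apply, map_mul, map_pow,
        map_pow, rescale_h, rescale_x, one_smul, smul_pow, mul_smul_comm, smul_smul, pow_succ]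
  rw [LinearMap.sum_apply, Finset.sum_congr rfl fun l _ => pow_rescale l, ← Finset.sum_smul,
    LinearMap.smul_apply, AlgHom.toLinearMap_apply, map_mul, map_pow, map_pow, rescale_h, rescale_x,
    one_smul, zero_smul]
  rcases Nat.eq_zero_or_pos j with rfl | hj
  · simp
  rw [zero_pow hj.ne', mul_zero, smul_zero]
  rcases lt_or_ge j m with hjm | hjm
  · rw [geom_sum_eq (hq.pow_ne_one_of_pos_of_lt hj.ne' hjm), ← pow_mul, mul_comm j, pow_mul,
      hq.pow_eq_one, one_pow, sub_self, zero_div, zero_smul]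
  · rw [pow_eq_zero_of_le hjm (x_pow hq), mul_zero, smul_zero]

end rescale

/-- The representation `h ↦ diag(1, q)`, `x ↦ E₁₂`. -/
noncomputable def rep (hm : 1 < m) : Taft hq →ₐ[k] Matrix (Fin 2) (Fin 2) k :=
  lift hq (Matrix.diagonal ![1, q]) !![0, 1; 0, 0]
    (by
      rw [Matrix.diagonal_pow, ← Matrix.diagonal_one]
      congr 1
      ext i
      fin_cases i <;> simp [hq.pow_eq_one])
    (by
      have nilpotent : (!![0, 1; 0, 0] : Matrix (Fin 2) (Fin 2) k) ^ 2 = 0 := by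
        ext i j; fin_cases i <;> fin_cases j <;> simp [pow_two]
      exact pow_eq_zero_of_le hm nilpotent)
    (by ext i j; fin_cases i <;> fin_cases j <;> simp [Matrix.mul_apply, Fin.sum_univ_two])

/-- The functional with value `1` on the monomials `h ^ i x` and `0` on the monomials `h ^ i x ^ j`
with `j ≠ 1`, realised as the upper right coefficient of `rep`. -/
noncomputable def dualX (hm : 1 < m) : Module.Dual k (Taft hq) :=
  Matrix.entryLinearMap k k 0 1 ∘ₗ (rep hq hm).toLinearMap

section

variable (hm : 1 < m)

@[simp]
theorem dualX_one : dualX hq hm 1 = 0 := by simp [dualX]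

theorem dualX_comp_mulLeft_h : dualX hq hm ∘ₗ LinearMap.mulLeft k (h hq) = dualX hq hm := by
  ext a
  simp [dualX, rep, Matrix.mul_apply, Fin.sum_univ_two]

@[simp]
theorem dualX_h : dualX hq hm (h hq) = 0 := by
  simpa using LinearMap.congr_fun (dualX_comp_mulLeft_h hq hm) 1

end

variable [NeZero m]

theorem isGroupLikeElem_h : IsGroupLikeElem k (h hq) := ⟨counit_h hq, comul_h hq⟩

theorem isSkewPrimitive_x : IsSkewPrimitive k (h hq) (x hq) := comul_x hq

/-- The character `h ↦ q`, `x ↦ 0` of the Taft algebra. -/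
noncomputable def character : Taft hq →ₐ[k] k :=
  lift hq q 0 hq.pow_eq_one (zero_pow (NeZero.ne m)) (by simp)

@[simp]
theorem character_h : character hq (h hq) = q := lift_h hq _ _ _ _ _

@[simp]
theorem character_x : character hq (x hq) = 0 := lift_x hq _ _ _ _ _

theorem leftHit_character (a : Taft hq) :
    leftHit (character hq).toLinearMap a = rescale hq hq.pow_eq_one q a := by
  have h_mul : (character hq).toLinearMap ∘ₗ LinearMap.mulLeft k (h hq) =
    q • (character hq).toLinearMap := by ext; simp
  have x_mul : (character hq).toLinearMap ∘ₗ LinearMap.mulLeft k (x hq) = 0 := by ext; simp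
  refine LinearMap.congr_fun (g := (rescale hq hq.pow_eq_one q).toLinearMap)
    (linearMap_ext hq ?_ (fun a ha => ?_) fun a ha => ?_) a
  · simp [leftHit_of_isGroupLikeElem _ IsGroupLikeElem.one]
  · simp_all [leftHit_groupLike_mul _ (isGroupLikeElem_h hq)]
  · simp_all [leftHit_skewPrimitive_mul _ (isSkewPrimitive_x hq)]

theorem rightHit_character (a : Taft hq) :
    rightHit (character hq).toLinearMap a = rescale hq hq.pow_eq_one 1 a := by
  have h_mul : (character hq).toLinearMap ∘ₗ LinearMap.mulLeft k (h hq) =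
    q • (character hq).toLinearMap := by ext; simp
  have x_mul : (character hq).toLinearMap ∘ₗ LinearMap.mulLeft k (x hq) = 0 := by ext; simp
  refine LinearMap.congr_fun (g := (rescale hq hq.pow_eq_one 1).toLinearMap)
    (linearMap_ext hq ?_ (fun a ha => ?_) fun a ha => ?_) a
  · simp [rightHit_of_isGroupLikeElem _ IsGroupLikeElem.one]
  · simp_all [rightHit_groupLike_mul _ (isGroupLikeElem_h hq)]
  · simp_all [rightHit_skewPrimitive_mul _ (isSkewPrimitive_x hq)]

variable (hm : 1 < m)

theorem rep_one_one (a : Taft hq) : rep hq hm a 1 1 = character hq a := by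
  refine LinearMap.congr_fun (f := Matrix.entryLinearMap k k 1 1 ∘ₗ (rep hq hm).toLinearMap)
    (g := (character hq).toLinearMap) (linearMap_ext hq (by simp) (fun a ha => ?_) fun a _ => ?_) a
  · simp_all [rep, Matrix.mul_apply, Fin.sum_univ_two]
  · simp [rep, Matrix.vecMul, dotProduct, Fin.sum_univ_two]

theorem dualX_comp_mulLeft_x :
    dualX hq hm ∘ₗ LinearMap.mulLeft k (x hq) = (character hq).toLinearMap := by
  ext a
  rw [AlgHom.toLinearMap_apply, ← rep_one_one hq hm]
  simp [dualX, rep, Matrix.vecMul, dotProduct, Fin.sum_univ_two]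

@[simp]
theorem dualX_x : dualX hq hm (x hq) = 1 := by
  simpa using LinearMap.congr_fun (dualX_comp_mulLeft_x hq hm) 1

theorem leftHit_dualX_one : leftHit (dualX hq hm) 1 = 0 := by
  simp [leftHit_of_isGroupLikeElem _ IsGroupLikeElem.one]

theorem leftHit_dualX_h_mul (a : Taft hq) :
    leftHit (dualX hq hm) (h hq * a) = h hq * leftHit (dualX hq hm) a := by
  rw [leftHit_groupLike_mul _ (isGroupLikeElem_h hq), dualX_comp_mulLeft_h]

theorem leftHit_dualX_x_mul (a : Taft hq) :
    leftHit (dualX hq hm) (x hq * a) =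
      x hq * leftHit (dualX hq hm) a + rescale hq hq.pow_eq_one q a := by
  rw [leftHit_skewPrimitive_mul _ (isSkewPrimitive_x hq), dualX_comp_mulLeft_h,
    dualX_comp_mulLeft_x, leftHit_character]

theorem rightHit_dualX_one : rightHit (dualX hq hm) 1 = 0 := by
  simp [rightHit_of_isGroupLikeElem _ IsGroupLikeElem.one]

theorem rightHit_dualX_h_mul (a : Taft hq) :
    rightHit (dualX hq hm) (h hq * a) = h hq * rightHit (dualX hq hm) a := by
  rw [rightHit_groupLike_mul _ (isGroupLikeElem_h hq), dualX_comp_mulLeft_h]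

theorem rightHit_dualX_x_mul (a : Taft hq) :
    rightHit (dualX hq hm) (x hq * a) =
      x hq * rightHit (dualX hq hm) a + h hq * rescale hq hq.pow_eq_one 1 a := by
  rw [rightHit_skewPrimitive_mul _ (isSkewPrimitive_x hq), dualX_comp_mulLeft_x,
    rightHit_character, add_comm]

theorem leftHit_dualX_rescale {b : k} (hb : b ^ m = 1) (c : k) (a : Taft hq) :
    leftHit (dualX hq hm) (rescale hq hb c a) = c • rescale hq hb c (leftHit (dualX hq hm) a) := by
  refine LinearMap.congr_fun (f := leftHit (dualX hq hm) ∘ₗ (rescale hq hb c).toLinearMap)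
    (g := c • (rescale hq hb c).toLinearMap ∘ₗ leftHit (dualX hq hm))
    (linearMap_ext hq ?_ (fun a ha => ?_) fun a ha => ?_) a
  all_goals simp only [LinearMap.comp_apply, LinearMap.smul_apply, AlgHom.toLinearMap_apply] at *
  · simp [leftHit_dualX_one]
  · rw [map_mul, rescale_h, smul_mul_assoc, map_smul, leftHit_dualX_h_mul, ha, leftHit_dualX_h_mul,
      map_mul, rescale_h, mul_smul_comm, smul_mul_assoc, smul_comm]
  · have hbq : (b * q) ^ m = 1 := by rw [mul_pow, hb, hq.pow_eq_one, one_mul]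
    rw [map_mul, rescale_x, smul_mul_assoc, map_smul, leftHit_dualX_x_mul, ha, leftHit_dualX_x_mul,
      map_add, map_mul, rescale_x, mul_smul_comm, smul_mul_assoc,
      rescale_rescale hq hq.pow_eq_one hb q c hbq (mul_comm q b),
      rescale_rescale hq hb hq.pow_eq_one c q hbq rfl, mul_comm q c]

theorem smul_rightHit_dualX_rescale {b : k} (hb : b ^ m = 1) (c : k) (a : Taft hq) :
    b • rightHit (dualX hq hm) (rescale hq hb c a) =
      c • rescale hq hb c (rightHit (dualX hq hm) a) := by
  refine LinearMap.congr_fun (f := b • rightHit (dualX hq hm) ∘ₗ (rescale hq hb c).toLinearMap)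
    (g := c • (rescale hq hb c).toLinearMap ∘ₗ rightHit (dualX hq hm))
    (linearMap_ext hq ?_ (fun a ha => ?_) fun a ha => ?_) a
  all_goals simp only [LinearMap.comp_apply, LinearMap.smul_apply, AlgHom.toLinearMap_apply] at *
  · simp [rightHit_dualX_one]
  · rw [map_mul, rescale_h, smul_mul_assoc, map_smul, rightHit_dualX_h_mul, rightHit_dualX_h_mul,
      map_mul, rescale_h, ← mul_smul_comm b, ha, mul_smul_comm, smul_mul_assoc, smul_comm]
  · have hbq : (b * q) ^ m = 1 := by rw [mul_pow, hb, hq.pow_eq_one, one_mul]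
    rw [map_mul, rescale_x, smul_mul_assoc, map_smul, rightHit_dualX_x_mul, smul_comm, smul_add,
      ← mul_smul_comm b, ha, rightHit_dualX_x_mul, map_add, map_mul, map_mul, rescale_x, rescale_h,
      mul_smul_comm, smul_mul_assoc, smul_mul_assoc,
      rescale_rescale hq hq.pow_eq_one hb 1 c hbq (mul_comm q b),
      rescale_rescale hq hb hq.pow_eq_one c 1 hbq rfl, mul_comm 1 c]

theorem leftHit_dualX_pow : leftHit (dualX hq hm) ^ m = 0 := by
  set N := leftHit (dualX hq hm) with hN
  set r := (rescale hq hq.pow_eq_one q).toLinearMap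
  have commutator :
      N * LinearMap.mulLeft k (x hq) - (1 : k) • (LinearMap.mulLeft k (x hq) * N) = r :=
    LinearMap.ext fun a => by simp [hN, leftHit_dualX_x_mul, r]
  have N_mul_r : N * r = q • (r * N) :=
    LinearMap.ext fun a => leftHit_dualX_rescale hq hm hq.pow_eq_one q a
  have commute_h : Commute N (LinearMap.mulLeft k (h hq)) :=
    LinearMap.ext fun a => leftHit_dualX_h_mul hq hm a
  have commute_x : N ^ m * LinearMap.mulLeft k (x hq) = LinearMap.mulLeft k (x hq) * N ^ m := by
    rw [pow_mul_eq_smul_add_sum (1 : k), commutator,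
      sum_pow_mul_mul_pow_eq_zero (c := q) (by rw [one_pow, hq.pow_eq_one]) (hq.ne_one hm).symm
        N_mul_r, one_pow, one_smul, add_zero]
  refine linearMap_ext hq ?_ (fun a ha => ?_) fun a ha => ?_
  · rw [Module.End.pow_map_zero_of_le hm.le, LinearMap.zero_apply]
    rw [pow_one, hN, leftHit_dualX_one]
  · refine (LinearMap.congr_fun (commute_h.pow_left m).eq a).trans ?_
    rw [Module.End.mul_apply, ha, LinearMap.zero_apply, map_zero, LinearMap.zero_apply]
  · refine (LinearMap.congr_fun commute_x a).trans ?_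
    rw [Module.End.mul_apply, ha, LinearMap.zero_apply, map_zero, LinearMap.zero_apply]

theorem smul_mulRight_x_mul_leftHit_dualX :
    (q - 1) • (LinearMap.mulRight k (x hq) * leftHit (dualX hq hm)) =
      (rescale hq (one_pow m) q).toLinearMap - 1 := by
  refine linearMap_ext hq ?_ (fun a ha => ?_) fun a ha => ?_
  all_goals simp only [Module.End.mul_apply, LinearMap.smul_apply, AlgHom.toLinearMap_apply,
    LinearMap.mulRight_apply, LinearMap.sub_apply, Module.End.one_apply] at *
  · simp [leftHit_dualX_one]
  · rw [leftHit_dualX_h_mul, mul_assoc, ← mul_smul_comm, ha, map_mul, rescale_h, one_smul, mul_sub]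
  · have x_mul_rescale : rescale hq hq.pow_eq_one q a * x hq =
        x hq * rescale hq (one_pow m) q a := by
      rw [x_mul, rescale_rescale hq hq.pow_eq_one (one_pow m) 1 q hq.pow_eq_one (mul_one q),
        one_mul]
    rw [leftHit_dualX_x_mul, add_mul, smul_add, mul_assoc, ← mul_smul_comm, ha, x_mul_rescale,
      map_mul, rescale_x, mul_sub, sub_smul, smul_mul_assoc, one_smul]
    abel

/- `Φ` is meant to be one of the two actions of `End (Taft hq)` on a tensor product. -/
theorem algHom_rescale_zero_apply {W : Type*} [AddCommGroup W] [Module k W]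
    (Φ : Module.End k (Taft hq) →ₐ[k] Module.End k W) {w : W}
    (hw : Φ (leftHit (dualX hq hm)) w = 0) :
    Φ (rescale hq (one_pow m) 0).toLinearMap w = w := by
  set θ := (rescale hq (one_pow m) q).toLinearMap with hθ
  have fixed : Φ θ w = w := by
    have := congrArg (fun f => Φ f w) (smul_mulRight_x_mul_leftHit_dualX hq hm)
    exact sub_eq_zero.1 (by simpa [hw] using this.symm)
  have pow_fixed : ∀ l, (Φ θ ^ l) w = w := by
    intro l
    induction l with
    | zero => rfl
    | succ l ih => rw [pow_succ, Module.End.mul_apply, fixed, ih]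
  have m_ne_zero : (m : k) ≠ 0 := hq.neZero'.ne
  have average := congrArg (fun f => Φ f w) (sum_rescale_pow hq)
  simp only [← hθ, map_sum, map_pow, map_smul, LinearMap.sum_apply, LinearMap.smul_apply,
    pow_fixed, Finset.sum_const, Finset.card_range, ← Nat.cast_smul_eq_nsmul k] at average
  exact (smul_right_injective W m_ne_zero average).symm

theorem rescale_zero_mem_span (a : Taft hq) :
    rescale hq (one_pow m) 0 a ∈ Submodule.span k {g : Taft hq | IsGroupLikeElem k g} := by
  refine left_induction hq (p := (Submodule.span k {g : Taft hq | IsGroupLikeElem k g}).comap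
    (rescale hq (one_pow m) 0).toLinearMap) ?_ (fun a ha => ?_) (fun a _ => ?_) a
  all_goals simp only [Submodule.mem_comap, AlgHom.toLinearMap_apply, map_mul, map_one, rescale_h,
    rescale_x, one_smul, zero_smul, zero_mul, Submodule.zero_mem] at *
  · exact Submodule.subset_span IsGroupLikeElem.one
  · refine (Submodule.map_span_le (LinearMap.mulLeft k (h hq)) _ _).2 (fun g hg => ?_)
      (Submodule.mem_map_of_mem ha)
    exact Submodule.subset_span ((isGroupLikeElem_h hq).mul hg)

end Taft

section TensorProduct

variable {R A B : Type*} [CommSemiring R] [Semiring A] [Bialgebra R A] [Semiring B] [Bialgebra R B]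

theorem isGroupLikeElem_tmul {g : A} {g' : B} (hg : IsGroupLikeElem R g)
    (hg' : IsGroupLikeElem R g') : IsGroupLikeElem R (g ⊗ₜ[R] g') :=
  ⟨by simp [hg.counit_eq_one, hg'.counit_eq_one],
    by simp [TensorProduct.comul_tmul, hg.comul_eq_tmul_self, hg'.comul_eq_tmul_self]⟩

theorem IsSkewPrimitive.tmul_one {g y : A} (hy : IsSkewPrimitive R g y) :
    IsSkewPrimitive R (g ⊗ₜ[R] (1 : B)) (y ⊗ₜ[R] (1 : B)) := by
  simp [IsSkewPrimitive, TensorProduct.comul_tmul, hy.comul_eq, TensorProduct.add_tmul,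
    Algebra.TensorProduct.one_def]

theorem IsSkewPrimitive.one_tmul {g y : B} (hy : IsSkewPrimitive R g y) :
    IsSkewPrimitive R ((1 : A) ⊗ₜ[R] g) ((1 : A) ⊗ₜ[R] y) := by
  simp [IsSkewPrimitive, TensorProduct.comul_tmul, hy.comul_eq, TensorProduct.tmul_add,
    Algebra.TensorProduct.one_def]

end TensorProduct

namespace IsSkewPrimitive

section

variable {R A : Type*} [CommRing R] [Ring A] [Bialgebra R A] {g y z : A}

theorem sub (hy : IsSkewPrimitive R g y) (hz : IsSkewPrimitive R g z) :
    IsSkewPrimitive R g (y - z) := by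
  rw [IsSkewPrimitive, map_sub, hy.comul_eq, hz.comul_eq, TensorProduct.sub_tmul,
    TensorProduct.tmul_sub]
  abel

theorem smul (hy : IsSkewPrimitive R g y) (r : R) : IsSkewPrimitive R g (r • y) := by
  rw [IsSkewPrimitive, map_smul, hy.comul_eq, smul_add, TensorProduct.smul_tmul',
    TensorProduct.tmul_smul]

end

variable {k A : Type*} [Field k] [Ring A] [Bialgebra k A] {g y : A}

theorem exists_eq_smul_sub_one_of_mem_span (hy : IsSkewPrimitive k g y) (hg : g ≠ 1)
    (hspan : y ∈ Submodule.span k {g : A | IsGroupLikeElem k g}) : ∃ e : k, y = e • (g - 1) := by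
  obtain ⟨f, hf⟩ := Module.Projective.exists_dual_eq_one k (sub_ne_zero.2 hg)
  have hits := leftHit_eq_rightHit_of_mem_span hspan f
  rw [hy.leftHit_eq, hy.rightHit_eq] at hits
  refine ⟨f y, ?_⟩
  calc y = f (g - 1) • y := by rw [hf, one_smul]
    _ = f y • (g - 1) := by
      rw [map_sub, sub_smul, smul_sub, sub_eq_sub_iff_add_eq_add, hits]

end IsSkewPrimitive

section TaftTensorTaft

variable {k : Type*} [Field k] {m n : ℕ} {q q' : k}
  (hq : IsPrimitiveRoot q m) (hq' : IsPrimitiveRoot q' n) (hm : 1 < m) (hn : 1 < n)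

section dualLeft

variable [NeZero m]

/-- The functional dual to `X ⊗ 1`. -/
noncomputable def dualLeft : Module.Dual k (Taft hq' ⊗[k] Taft hq) :=
  TensorProduct.dualDistrib k _ _ (Taft.dualX hq' hn ⊗ₜ counit)

@[simp]
theorem dualLeft_tmul (a : Taft hq') (b : Taft hq) :
    dualLeft hq hq' hn (a ⊗ₜ b) = Taft.dualX hq' hn a * counit (R := k) b := rfl

end dualLeft

section dualRight

variable [NeZero n]

/-- The functional dual to `1 ⊗ x`. -/
noncomputable def dualRight : Module.Dual k (Taft hq' ⊗[k] Taft hq) :=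
  TensorProduct.dualDistrib k _ _ (counit ⊗ₜ Taft.dualX hq hm)

@[simp]
theorem dualRight_tmul (a : Taft hq') (b : Taft hq) :
    dualRight hq hq' hm (a ⊗ₜ b) = counit (R := k) a * Taft.dualX hq hm b := rfl

end dualRight

variable [NeZero m] [NeZero n]

theorem leftHit_dualLeft :
    leftHit (dualLeft hq hq' hn) = (leftHit (Taft.dualX hq' hn)).rTensor (Taft hq) := by
  rw [dualLeft, leftHit_dualDistrib, leftHit_counit, LinearMap.rTensor]

theorem leftHit_dualRight :
    leftHit (dualRight hq hq' hm) = (leftHit (Taft.dualX hq hm)).lTensor (Taft hq') := by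
  rw [dualRight, leftHit_dualDistrib, leftHit_counit, LinearMap.lTensor]

theorem commute_leftHit_dualLeft_leftHit_dualRight :
    Commute (leftHit (dualLeft hq hq' hn)) (leftHit (dualRight hq hq' hm)) := by
  rw [leftHit_dualLeft, leftHit_dualRight, Commute, SemiconjBy, Module.End.mul_eq_comp,
    Module.End.mul_eq_comp, LinearMap.rTensor_comp_lTensor, LinearMap.lTensor_comp_rTensor]

theorem isNilpotent_leftHit_dualLeft : IsNilpotent (leftHit (dualLeft hq hq' hn)) :=
  ⟨n, by rw [leftHit_dualLeft, LinearMap.rTensor_pow, Taft.leftHit_dualX_pow,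
    LinearMap.rTensor_zero]⟩

theorem isNilpotent_leftHit_dualRight : IsNilpotent (leftHit (dualRight hq hq' hm)) :=
  ⟨m, by rw [leftHit_dualRight, LinearMap.lTensor_pow, Taft.leftHit_dualX_pow,
    LinearMap.lTensor_zero]⟩

theorem map_rescale_zero_mem_span (w : Taft hq' ⊗[k] Taft hq) :
    TensorProduct.map (Taft.rescale hq' (one_pow n) 0).toLinearMap
        (Taft.rescale hq (one_pow m) 0).toLinearMap w ∈
      Submodule.span k {g : Taft hq' ⊗[k] Taft hq | IsGroupLikeElem k g} := by
  induction w using TensorProduct.induction_on with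
  | zero => rw [map_zero]; exact Submodule.zero_mem _
  | add s t hs ht => rw [map_add]; exact Submodule.add_mem _ hs ht
  | tmul a b =>
    have := Submodule.apply_mem_map₂ (TensorProduct.mk k _ _) (Taft.rescale_zero_mem_span hq' a)
      (Taft.rescale_zero_mem_span hq b)
    rw [Submodule.map₂_span_span] at this
    refine Submodule.span_mono ?_ this
    rintro _ ⟨g, hg, g', hg', rfl⟩
    exact isGroupLikeElem_tmul hg hg'

theorem mem_span_of_leftHit_eq_zero {w : Taft hq' ⊗[k] Taft hq}
    (hleft : leftHit (dualLeft hq hq' hn) w = 0) (hright : leftHit (dualRight hq hq' hm) w = 0) :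
    w ∈ Submodule.span k {g : Taft hq' ⊗[k] Taft hq | IsGroupLikeElem k g} := by
  rw [leftHit_dualLeft] at hleft
  rw [leftHit_dualRight] at hright
  have fixed_left : (Taft.rescale hq' (one_pow n) 0).toLinearMap.rTensor (Taft hq) w = w :=
    Taft.algHom_rescale_zero_apply hq' hn (Module.End.rTensorAlgHom k _ (Taft hq)) hleft
  have fixed_right : (Taft.rescale hq (one_pow m) 0).toLinearMap.lTensor (Taft hq') w = w :=
    Taft.algHom_rescale_zero_apply hq hm (Module.End.lTensorAlgHom k _ (Taft hq')) hright
  have := map_rescale_zero_mem_span hq hq' w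
  rwa [← LinearMap.rTensor_comp_lTensor, LinearMap.comp_apply, fixed_right, fixed_left] at this

variable {g y : Taft hq' ⊗[k] Taft hq}

theorem sub_smul_X_sub_smul_x_mem_span (hg : IsGroupLikeElem k g) (hy : IsSkewPrimitive k g y) :
    y - dualLeft hq hq' hn y • (Taft.x hq' ⊗ₜ 1) - dualRight hq hq' hm y • (1 ⊗ₜ Taft.x hq) ∈
      Submodule.span k {g : Taft hq' ⊗[k] Taft hq | IsGroupLikeElem k g} := by
  have left_g := apply_eq_zero_of_isNilpotent_leftHit (isNilpotent_leftHit_dualLeft hq hq' hn) hg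
  have right_g := apply_eq_zero_of_isNilpotent_leftHit (isNilpotent_leftHit_dualRight hq hq' hm) hg
  have skew_X := (Taft.isSkewPrimitive_x hq').tmul_one (B := Taft hq)
  have skew_x := (Taft.isSkewPrimitive_x hq).one_tmul (A := Taft hq')
  apply mem_span_of_leftHit_eq_zero hq hq' hm hn
  · simp [hy.leftHit_eq, skew_X.leftHit_eq, skew_x.leftHit_eq, left_g]
  · simp [hy.leftHit_eq, skew_X.leftHit_eq, skew_x.leftHit_eq, right_g]

include hm in
theorem eq_h_tmul_one_of_dualLeft_ne_zero (hg : IsGroupLikeElem k g) (hy : IsSkewPrimitive k g y)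
    (hne : dualLeft hq hq' hn y ≠ 0) : g = Taft.h hq' ⊗ₜ 1 := by
  have left_g := apply_eq_zero_of_isNilpotent_leftHit (isNilpotent_leftHit_dualLeft hq hq' hn) hg
  have skew_X := (Taft.isSkewPrimitive_x hq').tmul_one (B := Taft hq)
  have skew_x := (Taft.isSkewPrimitive_x hq).one_tmul (A := Taft hq')
  have hits := leftHit_eq_rightHit_of_mem_span
    (sub_smul_X_sub_smul_x_mem_span hq hq' hm hn hg hy) (dualLeft hq hq' hn)
  simp only [map_sub, map_smul, hy.leftHit_eq, hy.rightHit_eq, skew_X.leftHit_eq,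
    skew_X.rightHit_eq, skew_x.leftHit_eq, skew_x.rightHit_eq, left_g] at hits
  refine smul_right_injective _ hne (sub_eq_zero.1 ?_)
  simpa [Algebra.TensorProduct.one_def] using hits.symm

include hn in
theorem eq_one_tmul_h_of_dualRight_ne_zero (hg : IsGroupLikeElem k g) (hy : IsSkewPrimitive k g y)
    (hne : dualRight hq hq' hm y ≠ 0) : g = 1 ⊗ₜ Taft.h hq := by
  have right_g := apply_eq_zero_of_isNilpotent_leftHit (isNilpotent_leftHit_dualRight hq hq' hm) hg
  have skew_X := (Taft.isSkewPrimitive_x hq').tmul_one (B := Taft hq)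
  have skew_x := (Taft.isSkewPrimitive_x hq).one_tmul (A := Taft hq')
  have hits := leftHit_eq_rightHit_of_mem_span
    (sub_smul_X_sub_smul_x_mem_span hq hq' hm hn hg hy) (dualRight hq hq' hm)
  simp only [map_sub, map_smul, hy.leftHit_eq, hy.rightHit_eq, skew_X.leftHit_eq,
    skew_X.rightHit_eq, skew_x.leftHit_eq, skew_x.rightHit_eq, right_g] at hits
  refine smul_right_injective _ hne (sub_eq_zero.1 ?_)
  simpa [Algebra.TensorProduct.one_def] using hits.symm

include hm hn in
theorem exists_eq_of_isSkewPrimitive (hg : IsGroupLikeElem k g) (hg1 : g ≠ 1)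
    (hy : IsSkewPrimitive k g y) :
    ∃ c d e : k, y = c • (Taft.x hq' ⊗ₜ 1) + d • (1 ⊗ₜ Taft.x hq) + e • (g - 1) ∧
      (c ≠ 0 → g = Taft.h hq' ⊗ₜ 1) ∧ (d ≠ 0 → g = 1 ⊗ₜ Taft.h hq) := by
  have g_of_left := eq_h_tmul_one_of_dualLeft_ne_zero hq hq' hm hn hg hy
  have g_of_right := eq_one_tmul_h_of_dualRight_ne_zero hq hq' hm hn hg hy
  set c := dualLeft hq hq' hn y
  set d := dualRight hq hq' hm y
  have skew_cX : IsSkewPrimitive k g (c • (Taft.x hq' ⊗ₜ[k] (1 : Taft hq))) := by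
    rcases eq_or_ne c 0 with h0 | h0
    · simp [h0, IsSkewPrimitive]
    · exact g_of_left h0 ▸ (Taft.isSkewPrimitive_x hq').tmul_one.smul c
  have skew_dx : IsSkewPrimitive k g (d • ((1 : Taft hq') ⊗ₜ[k] Taft.x hq)) := by
    rcases eq_or_ne d 0 with h0 | h0
    · simp [h0, IsSkewPrimitive]
    · exact g_of_right h0 ▸ (Taft.isSkewPrimitive_x hq).one_tmul.smul d
  obtain ⟨e, he⟩ := ((hy.sub skew_cX).sub skew_dx).exists_eq_smul_sub_one_of_mem_span hg1
    (sub_smul_X_sub_smul_x_mem_span hq hq' hm hn hg hy)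
  refine ⟨c, d, e, ?_, g_of_left, g_of_right⟩
  rw [← he]
  abel

include hm hn in
theorem eq_zero_of_comul_eq_add_smul {c : k} {z : Taft hq' ⊗[k] Taft hq} (hg : IsGroupLikeElem k g)
    (hz : comul (R := k) z = z ⊗ₜ g + 1 ⊗ₜ z +
      c • ((Taft.x hq' ⊗ₜ[k] (1 : Taft hq)) ⊗ₜ[k] (Taft.h hq' ⊗ₜ[k] Taft.x hq))) : c = 0 := by
  have left_g := apply_eq_zero_of_isNilpotent_leftHit (isNilpotent_leftHit_dualLeft hq hq' hn) hg
  have right_g := apply_eq_zero_of_isNilpotent_leftHit (isNilpotent_leftHit_dualRight hq hq' hm) hg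
  have hit_one : ∀ f : Module.Dual k (Taft hq' ⊗[k] Taft hq), leftHit f 1 = f 1 • 1 :=
    fun f => leftHit_of_isGroupLikeElem f IsGroupLikeElem.one
  have left_z : leftHit (dualLeft hq hq' hn) z = dualLeft hq hq' hn z • 1 := by
    simp [leftHit_apply, hz, left_g]
  have right_z : leftHit (dualRight hq hq' hm) z =
      dualRight hq hq' hm z • 1 + c • (Taft.x hq' ⊗ₜ 1) := by
    simp [leftHit_apply, hz, right_g, Taft.counit_h]
  have left_X : leftHit (dualLeft hq hq' hn) (Taft.x hq' ⊗ₜ 1) = 1 := by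
    rw [(Taft.isSkewPrimitive_x hq').tmul_one.leftHit_eq]
    simp
  -- The hits commute, but their two composites send `z` to `c • 1` and to `0`.
  have commute := LinearMap.congr_fun
    (commute_leftHit_dualLeft_leftHit_dualRight hq hq' hm hn).eq z
  rw [Module.End.mul_apply, Module.End.mul_apply, left_z, right_z, map_add, map_smul, map_smul,
    map_smul, hit_one, hit_one, left_X] at commute
  simpa [Algebra.TensorProduct.one_def] using congrArg (counit (R := k)) commute

end TaftTensorTaft

/-- The parameters for which the defining relations of `TwoTaft` are consistent, that is for which
`TwoTaft` has the expected dimension. -/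
structure IsAdmissible {k : Type*} [Field k] (m n : ℕ) (q q' σ α : k) : Prop where
  pow_left : σ ^ n = 1
  pow_right : σ ^ m = 1
  eq_zero_or : α = 0 ∨ σ = q ∧ q' * q = 1

section Straightening

variable {k : Type*} [Field k] {n : ℕ} [NeZero n] {q' σ : k}
  (hq' : IsPrimitiveRoot q' n) (hn : 1 < n)
  (hσ : σ ^ n = 1) (α : k)

/-- The coefficient of `1` in the straightening rule
`x a = ψ(a) x + straightenOne a + straightenH a h`, for `a` in the Taft algebra generated by
`H` and `X` and `ψ` the rescaling `H ↦ σ H`, `X ↦ σ X`. -/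
noncomputable def straightenOne : Module.End k (Taft hq') :=
  α • (Taft.rescale hq' hσ σ).toLinearMap ∘ₗ leftHit (Taft.dualX hq' hn)

/-- The coefficient of `h` in the straightening rule
`x a = ψ(a) x + straightenOne a + straightenH a h`, for `a` in the Taft algebra generated by
`H` and `X` and `ψ` the rescaling `H ↦ σ H`, `X ↦ σ X`. -/
noncomputable def straightenH : Module.End k (Taft hq') :=
  -(α * q') • (Taft.rescale hq' hσ σ).toLinearMap ∘ₗ rightHit (Taft.dualX hq' hn)

theorem straightenOne_apply (a : Taft hq') : straightenOne hq' hn hσ α a =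
    α • Taft.rescale hq' hσ σ (leftHit (Taft.dualX hq' hn) a) := rfl

theorem straightenH_apply (a : Taft hq') : straightenH hq' hn hσ α a =
    -(α * q') • Taft.rescale hq' hσ σ (rightHit (Taft.dualX hq' hn) a) := rfl

@[simp]
theorem straightenOne_one : straightenOne hq' hn hσ α 1 = 0 := by
  rw [straightenOne_apply, Taft.leftHit_dualX_one, map_zero, smul_zero]

@[simp]
theorem straightenH_one : straightenH hq' hn hσ α 1 = 0 := by
  rw [straightenH_apply, Taft.rightHit_dualX_one, map_zero, smul_zero]

theorem straightenOne_h_mul (a : Taft hq') : straightenOne hq' hn hσ α (Taft.h hq' * a) =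
    σ • (Taft.h hq' * straightenOne hq' hn hσ α a) := by
  simp only [straightenOne_apply, Taft.leftHit_dualX_h_mul, map_mul, Taft.rescale_h,
    smul_mul_assoc, mul_smul_comm]
  rw [smul_comm]

theorem straightenH_h_mul (a : Taft hq') : straightenH hq' hn hσ α (Taft.h hq' * a) =
    σ • (Taft.h hq' * straightenH hq' hn hσ α a) := by
  simp only [straightenH_apply, Taft.rightHit_dualX_h_mul, map_mul, Taft.rescale_h,
    smul_mul_assoc, mul_smul_comm]
  rw [smul_comm]

variable {hq' hσ α} {m : ℕ} {q : k} (hadm : IsAdmissible m n q q' σ α)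
include hadm

theorem straightenOne_x_mul (a : Taft hq') : straightenOne hq' hn hσ α (Taft.x hq' * a) =
    σ • (Taft.x hq' * straightenOne hq' hn hσ α a) + α • a := by
  rcases hadm.eq_zero_or with rfl | ⟨rfl, hinv⟩
  · simp [straightenOne_apply]
  rw [straightenOne_apply, Taft.leftHit_dualX_x_mul, map_add,
    Taft.rescale_rescale hq' hσ hq'.pow_eq_one _ _ (one_pow n) (mul_comm σ q' ▸ hinv),
    mul_comm σ q', hinv, Taft.rescale_one_one, map_mul, Taft.rescale_x, smul_add, smul_mul_assoc,
    smul_comm, straightenOne_apply, mul_smul_comm]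

theorem straightenH_x_mul (a : Taft hq') : straightenH hq' hn hσ α (Taft.x hq' * a) =
    σ • (Taft.x hq' * straightenH hq' hn hσ α a) -
      α • (Taft.h hq' * Taft.rescale hq' (one_pow n) σ a) := by
  rcases hadm.eq_zero_or with rfl | ⟨rfl, hinv⟩
  · simp [straightenH_apply]
  rw [straightenH_apply, Taft.rightHit_dualX_x_mul, map_add, map_mul, map_mul, Taft.rescale_x,
    Taft.rescale_h, Taft.rescale_rescale hq' hσ hq'.pow_eq_one _ _ (one_pow n)
      (mul_comm σ q' ▸ hinv), mul_one, smul_add, smul_mul_assoc, smul_comm, straightenH_apply,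
    mul_smul_comm, smul_mul_assoc, smul_smul _ σ, neg_mul, mul_assoc, hinv, mul_one, neg_smul α,
    sub_eq_add_neg]

theorem straightenOne_rescale (a : Taft hq') :
    straightenOne hq' hn hσ α (Taft.rescale hq' (one_pow n) σ a) =
      q • Taft.rescale hq' (one_pow n) σ (straightenOne hq' hn hσ α a) := by
  rcases hadm.eq_zero_or with rfl | ⟨rfl, -⟩
  · simp [straightenOne_apply]
  rw [straightenOne_apply, Taft.leftHit_dualX_rescale, map_smul, smul_comm, straightenOne_apply,
    map_smul, Taft.rescale_rescale hq' hσ (one_pow n) _ _ hσ (mul_one σ),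
    Taft.rescale_rescale hq' (one_pow n) hσ _ _ hσ (one_mul σ)]

theorem straightenH_rescale (a : Taft hq') :
    straightenH hq' hn hσ α (Taft.rescale hq' (one_pow n) σ a) =
      q • Taft.rescale hq' (one_pow n) σ (straightenH hq' hn hσ α a) := by
  rcases hadm.eq_zero_or with rfl | ⟨rfl, -⟩
  · simp [straightenH_apply]
  have rightHit_rescale := Taft.smul_rightHit_dualX_rescale hq' hn (one_pow n) σ a
  rw [one_smul] at rightHit_rescale
  rw [straightenH_apply, rightHit_rescale, map_smul, smul_comm, straightenH_apply,
    map_smul, Taft.rescale_rescale hq' hσ (one_pow n) _ _ hσ (mul_one σ),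
    Taft.rescale_rescale hq' (one_pow n) hσ _ _ hσ (one_mul σ)]

end Straightening

section Operators

variable {k : Type*} [Field k] {m n : ℕ} {q q' σ : k} (hq : IsPrimitiveRoot q m)
  (hq' : IsPrimitiveRoot q' n)

/-- Left multiplication by `a ∈ Taft hq'` on `Taft hq' ⊗ W`. -/
noncomputable def leftMul (W : Type*) [AddCommGroup W] [Module k W] :
    Taft hq' →ₐ[k] Module.End k (Taft hq' ⊗[k] W) :=
  (Module.End.rTensorAlgHom k (Taft hq') W).comp (Algebra.lmul k (Taft hq'))

@[simp]
theorem leftMul_tmul {W : Type*} [AddCommGroup W] [Module k W] (a b : Taft hq') (w : W) :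
    leftMul hq' W a (b ⊗ₜ w) = (a * b) ⊗ₜ w := rfl

theorem pow_eq_lTensor_pow {W : Type*} [AddCommGroup W] [Module k W]
    {f : Module.End k (Taft hq' ⊗[k] W)} {u : Module.End k W} (hf : ∀ w, f (1 ⊗ₜ w) = 1 ⊗ₜ u w)
    {i : ℕ} (commute_h : Commute (f ^ i) (leftMul hq' W (Taft.h hq')))
    (commute_x : Commute (f ^ i) (leftMul hq' W (Taft.x hq'))) :
    f ^ i = (u ^ i).lTensor (Taft hq') := by
  have pow_one_tmul (w : W) : (f ^ i) (1 ⊗ₜ w) = 1 ⊗ₜ (u ^ i) w := by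
    have := Function.Semiconj.iterate_right (f := TensorProduct.mk k (Taft hq') W 1)
      (fun w => (hf w).symm) i
    simpa only [Module.End.pow_apply, TensorProduct.mk_apply] using (this w).symm
  refine TensorProduct.ext' fun a w => LinearMap.congr_fun
    (f := (f ^ i) ∘ₗ (TensorProduct.mk k (Taft hq') W).flip w)
    (g := (TensorProduct.mk k (Taft hq') W).flip ((u ^ i) w))
    (Taft.linearMap_ext hq' (pow_one_tmul w) (fun a ha => ?_) fun a ha => ?_) a
  all_goals simp only [LinearMap.comp_apply, LinearMap.flip_apply, TensorProduct.mk_apply] at *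
  · rw [← leftMul_tmul, ← Module.End.mul_apply, commute_h.eq, Module.End.mul_apply, ha,
      leftMul_tmul]
  · rw [← leftMul_tmul, ← Module.End.mul_apply, commute_x.eq, Module.End.mul_apply, ha,
      leftMul_tmul]

/-- The operator by which `h` acts on `Taft hq' ⊗ Taft hq`. -/
noncomputable def actH (σ : k) : Module.End k (Taft hq' ⊗[k] Taft hq) :=
  TensorProduct.map (Taft.rescale hq' (one_pow n) σ).toLinearMap (LinearMap.mulLeft k (Taft.h hq))

theorem actH_tmul (a : Taft hq') (l : Taft hq) :
    actH hq hq' σ (a ⊗ₜ l) = Taft.rescale hq' (one_pow n) σ a ⊗ₜ (Taft.h hq * l) := rfl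

theorem actH_mul_leftMul_h :
    actH hq hq' σ * leftMul hq' _ (Taft.h hq') = leftMul hq' _ (Taft.h hq') * actH hq hq' σ :=
  TensorProduct.ext' fun a l => by simp [actH_tmul]

theorem actH_mul_leftMul_x :
    actH hq hq' σ * leftMul hq' _ (Taft.x hq') =
      σ • (leftMul hq' _ (Taft.x hq') * actH hq hq' σ) :=
  TensorProduct.ext' fun a l => by simp [actH_tmul, TensorProduct.smul_tmul']

theorem actH_pow (hσm : σ ^ m = 1) : actH hq hq' σ ^ m = 1 := by
  rw [pow_eq_lTensor_pow hq' (u := LinearMap.mulLeft k (Taft.h hq)) (by simp [actH_tmul]),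
    LinearMap.pow_mulLeft, Taft.h_pow, LinearMap.mulLeft_one, LinearMap.lTensor_id]
  · rfl
  · exact Commute.pow_left (actH_mul_leftMul_h hq hq') m
  · rw [Commute, SemiconjBy, pow_mul_of_qcomm (actH_mul_leftMul_x hq hq'), hσm, one_smul]

variable [NeZero n] (hσ : σ ^ n = 1) (hn : 1 < n) (α : k)

/-- The operator by which `x` acts on `Taft hq' ⊗ Taft hq`. -/
noncomputable def actX : Module.End k (Taft hq' ⊗[k] Taft hq) :=
  TensorProduct.map (Taft.rescale hq' hσ σ).toLinearMap (LinearMap.mulLeft k (Taft.x hq)) +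
    TensorProduct.map (straightenOne hq' hn hσ α) LinearMap.id +
    TensorProduct.map (straightenH hq' hn hσ α) (LinearMap.mulLeft k (Taft.h hq))

theorem actX_tmul (a : Taft hq') (l : Taft hq) :
    actX hq hq' hσ hn α (a ⊗ₜ l) = Taft.rescale hq' hσ σ a ⊗ₜ (Taft.x hq * l) +
      straightenOne hq' hn hσ α a ⊗ₜ l + straightenH hq' hn hσ α a ⊗ₜ (Taft.h hq * l) := rfl

theorem actX_mul_leftMul_h :
    actX hq hq' hσ hn α * leftMul hq' _ (Taft.h hq') =
      σ • (leftMul hq' _ (Taft.h hq') * actX hq hq' hσ hn α) :=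
  TensorProduct.ext' fun a l => by
    simp [actX_tmul, straightenOne_h_mul, straightenH_h_mul, TensorProduct.smul_tmul']

variable {hσ α} (hadm : IsAdmissible m n q q' σ α)
include hadm

theorem actX_mul_leftMul_x :
    actX hq hq' hσ hn α * leftMul hq' _ (Taft.x hq') -
        σ • (leftMul hq' _ (Taft.x hq') * actX hq hq' hσ hn α) =
      α • (1 - leftMul hq' _ (Taft.h hq') * actH hq hq' σ) := by
  refine TensorProduct.ext' fun a l => ?_
  simp only [Module.End.mul_apply, LinearMap.smul_apply, LinearMap.sub_apply,
    Module.End.one_apply, leftMul_tmul, actX_tmul, actH_tmul, map_add, map_mul,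
    straightenOne_x_mul hn hadm, straightenH_x_mul hn hadm, Taft.rescale_x, smul_mul_assoc,
    smul_add, smul_sub, ← TensorProduct.smul_tmul', TensorProduct.add_tmul,
    TensorProduct.sub_tmul]
  abel

theorem actX_mul_actH :
    actX hq hq' hσ hn α * actH hq hq' σ = q • (actH hq hq' σ * actX hq hq' hσ hn α) := by
  refine TensorProduct.ext' fun a l => ?_
  simp only [Module.End.mul_apply, LinearMap.smul_apply, actX_tmul, actH_tmul, map_add,
    straightenOne_rescale hn hadm, straightenH_rescale hn hadm, smul_add,
    Taft.rescale_rescale hq' hσ (one_pow n) _ _ hσ (mul_one σ),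
    Taft.rescale_rescale hq' (one_pow n) hσ _ _ hσ (one_mul σ)]
  rw [← mul_assoc, Taft.x_mul_h, smul_mul_assoc, TensorProduct.tmul_smul, mul_assoc,
    TensorProduct.smul_tmul', TensorProduct.smul_tmul', TensorProduct.smul_tmul']

end Operators

theorem commute_pow_of_isAdmissible {k B : Type*} [Field k] [Ring B] [Algebra k B] {m n : ℕ}
    {q q' σ α : k} (hq : IsPrimitiveRoot q m) (hm : 1 < m) (hadm : IsAdmissible m n q q' σ α)
    {h x H X : B} (x_mul_h : x * h = q • (h * x)) (x_mul_H : x * H = σ • (H * x))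
    (x_mul_X : x * X - σ • (X * x) = α • (1 - H * h)) : Commute (x ^ m) X := by
  rw [Commute, SemiconjBy]
  rcases hadm.eq_zero_or with rfl | ⟨rfl, -⟩
  · rw [zero_smul, sub_eq_zero] at x_mul_X
    rw [pow_mul_of_qcomm x_mul_X, hadm.pow_right, one_smul]
  have x_mul_Hh : x * (α • (H * h)) = (σ * σ) • (α • (H * h) * x) := by
    rw [mul_smul_comm, ← mul_assoc, x_mul_H, smul_mul_assoc, mul_assoc, x_mul_h, mul_smul_comm,
      smul_smul, smul_mul_assoc, mul_assoc, smul_smul, smul_smul, mul_assoc, mul_comm α]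
  have σ_ne_one : σ ≠ 1 := hq.ne_one hm
  have σ_ne_mul : σ ≠ σ * σ := fun h => σ_ne_one (mul_left_cancel₀ (hq.ne_zero (by omega))
    (by rw [mul_one, ← h]))
  rw [pow_mul_eq_smul_add_sum σ, x_mul_X, smul_sub, hadm.pow_right, one_smul]
  simp only [mul_sub, sub_mul, smul_sub, Finset.sum_sub_distrib]
  rw [sum_pow_mul_mul_pow_eq_zero (c := 1) (by rw [one_pow, hadm.pow_right]) σ_ne_one (by simp),
    sum_pow_mul_mul_pow_eq_zero (by rw [mul_pow, hadm.pow_right, one_mul]) σ_ne_mul x_mul_Hh,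
    sub_zero, add_zero]

section Operators

variable {k : Type*} [Field k] {m n : ℕ} {q q' σ α : k} [NeZero n] (hq : IsPrimitiveRoot q m)
  (hq' : IsPrimitiveRoot q' n) (hσ : σ ^ n = 1) (hm : 1 < m) (hn : 1 < n)
  (hadm : IsAdmissible m n q q' σ α)

include hm hadm in
theorem actX_pow : actX hq hq' hσ hn α ^ m = 0 := by
  rw [pow_eq_lTensor_pow hq' (u := LinearMap.mulLeft k (Taft.x hq)) (by simp [actX_tmul]),
    LinearMap.pow_mulLeft, Taft.x_pow, LinearMap.mulLeft_zero_eq_zero, LinearMap.lTensor_zero]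
  · rw [Commute, SemiconjBy, pow_mul_of_qcomm (actX_mul_leftMul_h hq hq' hσ hn α),
      hadm.pow_right, one_smul]
  · exact commute_pow_of_isAdmissible hq hm hadm (actX_mul_actH hq hq' hn hadm)
      (actX_mul_leftMul_h hq hq' hσ hn α) (actX_mul_leftMul_x hq hq' hn hadm)

include hm in
theorem twoTaftRelations_act :
    TwoTaftRelations m n q q' σ α (actH hq hq' σ) (actX hq hq' hadm.pow_left hn α)
      (leftMul hq' (Taft hq) (Taft.h hq')) (leftMul hq' (Taft hq) (Taft.x hq')) where
  h_pow := actH_pow hq hq' hadm.pow_right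
  H_pow := by rw [← map_pow, Taft.h_pow, map_one]
  x_pow := actX_pow hq hq' hadm.pow_left hm hn hadm
  X_pow := by rw [← map_pow, Taft.x_pow, map_zero]
  x_mul_h := actX_mul_actH hq hq' hn hadm
  X_mul_H := by rw [← map_mul, Taft.x_mul_h, map_smul, map_mul]
  x_mul_H := actX_mul_leftMul_h hq hq' hadm.pow_left hn α
  h_mul_X := actH_mul_leftMul_x hq hq'
  x_mul_X := actX_mul_leftMul_x hq hq' hn hadm
  h_mul_H := actH_mul_leftMul_h hq hq'

end Operators

section

variable {R A : Type*} [CommRing R] [Ring A] [Bialgebra R A] {g y : A}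

theorem IsSkewPrimitive.counit_eq_zero (hg : counit (R := R) g = 1) (hy : IsSkewPrimitive R g y) :
    counit (R := R) y = 0 := by
  have := congrArg (counit (R := R)) (hy.leftHit_eq (counit (R := R)))
  simpa [leftHit_counit, hg] using this

end

section mulTensor

variable {R A L E E' : Type*} [CommSemiring R] [Semiring A] [Bialgebra R A]
  [Semiring L] [Bialgebra R L] [Semiring E] [Bialgebra R E] [Semiring E'] [Bialgebra R E']

/-- The map `a ⊗ l ↦ i a * j l`, whose bijectivity makes `E` factor through `A` and `L`. -/
noncomputable def mulTensor (i : A →ₐc[R] E) (j : L →ₐc[R] E) : A ⊗[R] L →ₗ[R] E :=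
  LinearMap.mul' R E ∘ₗ TensorProduct.map (i : A →ₗ[R] E) (j : L →ₗ[R] E)

@[simp]
theorem mulTensor_tmul (i : A →ₐc[R] E) (j : L →ₐc[R] E) (a : A) (l : L) :
    mulTensor i j (a ⊗ₜ l) = i a * j l := rfl

theorem comp_mulTensor (f : E →ₐc[R] E') (i : A →ₐc[R] E) (j : L →ₐc[R] E) :
    (f : E →ₗ[R] E') ∘ₗ mulTensor i j = mulTensor (f.comp i) (f.comp j) :=
  TensorProduct.ext' fun a l => by simp

theorem injective_left_of_injective_mulTensor [Module.Flat R A] {i : A →ₐc[R] E} {j : L →ₐc[R] E}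
    (hij : Function.Injective (mulTensor i j)) : Function.Injective i := by
  convert hij.comp
    (Algebra.TensorProduct.includeLeft_injective (S := R) (Bialgebra.algebraMap_injective L))
  ext a
  simp

theorem injective_right_of_injective_mulTensor [Module.Flat R L] {i : A →ₐc[R] E} {j : L →ₐc[R] E}
    (hij : Function.Injective (mulTensor i j)) : Function.Injective j := by
  convert hij.comp (Algebra.TensorProduct.includeRight_injective (Bialgebra.algebraMap_injective A))
  ext l
  simp

end mulTensor

section BialgHom

variable {k E : Type*} [Field k] [Ring E] [Bialgebra k E] {m n : ℕ} [NeZero m] {q q' : k}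
  (hq : IsPrimitiveRoot q m)

/-- The bialgebra map out of the Taft algebra sending `h` to the group-like `a` and `x` to the
skew-primitive `b`. -/
noncomputable def Taft.liftBialgHom {a b : E} (a_pow : a ^ m = 1) (b_pow : b ^ m = 0)
    (b_mul_a : b * a = q • (a * b)) (ha : IsGroupLikeElem k a) (hb : IsSkewPrimitive k a b) :
    Taft hq →ₐc[k] E :=
  BialgHom.ofAlgHom (lift hq a b a_pow b_pow b_mul_a)
    (by
      apply algHom_ext <;>
        simp [counit_h, counit_x, ha.counit_eq_one, hb.counit_eq_zero ha.counit_eq_one])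
    (by apply algHom_ext <;> simp [comul_h, comul_x, ha.comul_eq_tmul_self, hb.comul_eq])

@[simp]
theorem Taft.liftBialgHom_h {a b : E} (a_pow : a ^ m = 1) (b_pow : b ^ m = 0)
    (b_mul_a : b * a = q • (a * b)) (ha : IsGroupLikeElem k a) (hb : IsSkewPrimitive k a b) :
    liftBialgHom hq a_pow b_pow b_mul_a ha hb (h hq) = a :=
  lift_h hq a b a_pow b_pow b_mul_a

@[simp]
theorem Taft.liftBialgHom_x {a b : E} (a_pow : a ^ m = 1) (b_pow : b ^ m = 0)
    (b_mul_a : b * a = q • (a * b)) (ha : IsGroupLikeElem k a) (hb : IsSkewPrimitive k a b) :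
    liftBialgHom hq a_pow b_pow b_mul_a ha hb (x hq) = b :=
  lift_x hq a b a_pow b_pow b_mul_a

theorem Taft.bialgHom_ext {f g : Taft hq →ₐc[k] E} (hh : f (h hq) = g (h hq))
    (hx : f (x hq) = g (x hq)) : f = g :=
  have toAlgHom_eq : (f : Taft hq →ₐ[k] E) = g := algHom_ext hq hh hx
  DFunLike.ext _ _ fun a => AlgHom.congr_fun toAlgHom_eq a

namespace TwoTaft

variable [NeZero n] (hq' : IsPrimitiveRoot q' n) (σ α : k)

section liftBialgHom

variable {σ α} {a b c d : E} (w : TwoTaftRelations m n q q' σ α a b c d)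
  (ha : IsGroupLikeElem k a) (hb : IsSkewPrimitive k a b) (hc : IsGroupLikeElem k c)
  (hd : IsSkewPrimitive k c d)

/-- The bialgebra map out of `TwoTaft` given by group-likes `a`, `c` and skew-primitives `b`, `d`
subject to the defining relations. -/
noncomputable def liftBialgHom : TwoTaft hq' hq σ α →ₐc[k] E :=
  BialgHom.ofAlgHom (lift hq' hq σ α w)
    (by
      apply algHom_ext <;>
        simp [counit_h, counit_x, counit_H, counit_X, ha.counit_eq_one, hc.counit_eq_one,
          hb.counit_eq_zero ha.counit_eq_one, hd.counit_eq_zero hc.counit_eq_one])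
    (by
      apply algHom_ext <;>
        simp [comul_h, comul_x, comul_H, comul_X, ha.comul_eq_tmul_self, hb.comul_eq,
          hc.comul_eq_tmul_self, hd.comul_eq])

@[simp]
theorem liftBialgHom_h : liftBialgHom hq hq' w ha hb hc hd (h hq' hq σ α) = a :=
  lift_h hq' hq σ α w

@[simp]
theorem liftBialgHom_x : liftBialgHom hq hq' w ha hb hc hd (x hq' hq σ α) = b :=
  lift_x hq' hq σ α w

@[simp]
theorem liftBialgHom_H : liftBialgHom hq hq' w ha hb hc hd (H hq' hq σ α) = c :=
  lift_H hq' hq σ α w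

@[simp]
theorem liftBialgHom_X : liftBialgHom hq hq' w ha hb hc hd (X hq' hq σ α) = d :=
  lift_X hq' hq σ α w

end liftBialgHom

theorem isGroupLikeElem_h : IsGroupLikeElem k (h hq' hq σ α) :=
  ⟨counit_h hq' hq σ α, comul_h hq' hq σ α⟩

theorem isGroupLikeElem_H : IsGroupLikeElem k (H hq' hq σ α) :=
  ⟨counit_H hq' hq σ α, comul_H hq' hq σ α⟩

/-- The inclusion of the Taft algebra generated by `H` and `X`. -/
noncomputable def inl : Taft hq' →ₐc[k] TwoTaft hq' hq σ α :=
  Taft.liftBialgHom hq' (relations hq' hq σ α).H_pow (relations hq' hq σ α).X_pow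
    (relations hq' hq σ α).X_mul_H (isGroupLikeElem_H hq hq' σ α) (comul_X hq' hq σ α)

/-- The inclusion of the Taft algebra generated by `h` and `x`. -/
noncomputable def inr : Taft hq →ₐc[k] TwoTaft hq' hq σ α :=
  Taft.liftBialgHom hq (relations hq' hq σ α).h_pow (relations hq' hq σ α).x_pow
    (relations hq' hq σ α).x_mul_h (isGroupLikeElem_h hq hq' σ α) (comul_x hq' hq σ α)

@[simp]
theorem inl_h : inl hq hq' σ α (Taft.h hq') = H hq' hq σ α := Taft.liftBialgHom_h ..

@[simp]
theorem inl_x : inl hq hq' σ α (Taft.x hq') = X hq' hq σ α := Taft.liftBialgHom_x ..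

@[simp]
theorem inr_h : inr hq hq' σ α (Taft.h hq) = h hq' hq σ α := Taft.liftBialgHom_h ..

@[simp]
theorem inr_x : inr hq hq' σ α (Taft.x hq) = x hq' hq σ α := Taft.liftBialgHom_x ..

/-- The multiplication map `a ⊗ l ↦ inl a * inr l`. -/
noncomputable def mulMap : Taft hq' ⊗[k] Taft hq →ₗ[k] TwoTaft hq' hq σ α :=
  mulTensor (inl hq hq' σ α) (inr hq hq' σ α)

@[simp]
theorem mulMap_tmul (a : Taft hq') (l : Taft hq) :
    mulMap hq hq' σ α (a ⊗ₜ l) = inl hq hq' σ α a * inr hq hq' σ α l := rfl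

theorem h_mul_inl (a : Taft hq') : h hq' hq σ α * inl hq hq' σ α a =
    inl hq hq' σ α (Taft.rescale hq' (one_pow n) σ a) * h hq' hq σ α := by
  have w := relations hq' hq σ α
  refine LinearMap.congr_fun
    (f := LinearMap.mulLeft k (h hq' hq σ α) ∘ₗ (inl hq hq' σ α : Taft hq' →ₗ[k] _))
    (g := LinearMap.mulRight k (h hq' hq σ α) ∘ₗ (inl hq hq' σ α : Taft hq' →ₗ[k] _) ∘ₗ
      (Taft.rescale hq' (one_pow n) σ).toLinearMap)
    (Taft.linearMap_ext hq' (by simp) (fun a ha => ?_) fun a ha => ?_) a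
  all_goals simp only [LinearMap.comp_apply, LinearMap.mulLeft_apply, LinearMap.mulRight_apply,
    AlgHom.toLinearMap_apply, LinearMap.coe_coe, map_mul, inl_h, inl_x, Taft.rescale_h,
    Taft.rescale_x, one_smul, smul_mul_assoc, map_smul] at *
  · rw [← mul_assoc, w.h_mul_H, mul_assoc, ha, mul_assoc]
  · rw [← mul_assoc, w.h_mul_X, smul_mul_assoc, mul_assoc, ha, mul_assoc]

variable {σ α}
variable (hn : 1 < n) (hadm : IsAdmissible m n q q' σ α)

theorem x_mul_inl (a : Taft hq') : x hq' hq σ α * inl hq hq' σ α a =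
    inl hq hq' σ α (Taft.rescale hq' hadm.pow_left σ a) * x hq' hq σ α +
      inl hq hq' σ α (straightenOne hq' hn hadm.pow_left α a) +
      inl hq hq' σ α (straightenH hq' hn hadm.pow_left α a) * h hq' hq σ α := by
  have w := relations hq' hq σ α
  refine LinearMap.congr_fun
    (f := LinearMap.mulLeft k (x hq' hq σ α) ∘ₗ (inl hq hq' σ α : Taft hq' →ₗ[k] _))
    (g := LinearMap.mulRight k (x hq' hq σ α) ∘ₗ (inl hq hq' σ α : Taft hq' →ₗ[k] _) ∘ₗ
        (Taft.rescale hq' hadm.pow_left σ).toLinearMap +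
      (inl hq hq' σ α : Taft hq' →ₗ[k] _) ∘ₗ straightenOne hq' hn hadm.pow_left α +
      LinearMap.mulRight k (h hq' hq σ α) ∘ₗ (inl hq hq' σ α : Taft hq' →ₗ[k] _) ∘ₗ
        straightenH hq' hn hadm.pow_left α)
    (Taft.linearMap_ext hq' (by simp) (fun a ha => ?_) fun a ha => ?_) a
  all_goals simp only [LinearMap.add_apply, LinearMap.comp_apply, LinearMap.mulLeft_apply,
    LinearMap.mulRight_apply, AlgHom.toLinearMap_apply, LinearMap.coe_coe, map_mul, inl_h, inl_x,
    Taft.rescale_h, Taft.rescale_x, smul_mul_assoc, map_smul, map_add, map_sub,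
    straightenOne_h_mul, straightenH_h_mul, straightenOne_x_mul hn hadm,
    straightenH_x_mul hn hadm] at *
  · rw [← mul_assoc, w.x_mul_H, smul_mul_assoc, mul_assoc, ha]
    simp only [mul_add, smul_add, mul_assoc]
  · rw [← mul_assoc, sub_eq_iff_eq_add.1 w.x_mul_X, add_mul, smul_mul_assoc, smul_mul_assoc,
      sub_mul, one_mul, mul_assoc, mul_assoc, ha, h_mul_inl]
    simp only [mul_add, smul_add, smul_sub, mul_assoc]
    abel

variable (hm : 1 < m)

/-- The action of `TwoTaft` on `Taft hq' ⊗ Taft hq` by left multiplication, as read off from the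
defining relations. -/
noncomputable def act : TwoTaft hq' hq σ α →ₐ[k] Module.End k (Taft hq' ⊗[k] Taft hq) :=
  lift hq' hq σ α (twoTaftRelations_act hq hq' hm hn hadm)

theorem act_inl (a : Taft hq') :
    act hq hq' hn hadm hm (inl hq hq' σ α a) = leftMul hq' (Taft hq) a :=
  DFunLike.congr_fun (Taft.algHom_ext hq' (f := (act hq hq' hn hadm hm).comp
    (inl hq hq' σ α : Taft hq' →ₐ[k] TwoTaft hq' hq σ α)) (by simp [act]) (by simp [act])) a

theorem act_inr_one_tmul_one (l : Taft hq) :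
    act hq hq' hn hadm hm (inr hq hq' σ α l) (1 ⊗ₜ 1) = 1 ⊗ₜ l := by
  refine LinearMap.congr_fun
    (f := LinearMap.applyₗ (1 ⊗ₜ 1) ∘ₗ (act hq hq' hn hadm hm).toLinearMap ∘ₗ
      (inr hq hq' σ α : Taft hq →ₗ[k] TwoTaft hq' hq σ α))
    (g := TensorProduct.mk k (Taft hq') (Taft hq) 1)
    (Taft.linearMap_ext hq ?_ (fun a ha => ?_) fun a ha => ?_) l
  all_goals simp only [LinearMap.comp_apply, LinearMap.applyₗ_apply_apply, LinearMap.coe_coe,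
    AlgHom.toLinearMap_apply, TensorProduct.mk_apply, map_one, map_mul, Module.End.one_apply,
    Module.End.mul_apply, inr_h, inr_x] at *
  · rw [ha, act, lift_h, actH_tmul, map_one]
  · rw [ha, act, lift_x, actX_tmul, map_one, straightenOne_one, straightenH_one,
      TensorProduct.zero_tmul, TensorProduct.zero_tmul, add_zero, add_zero]

theorem act_mulMap_one_tmul_one (t : Taft hq' ⊗[k] Taft hq) :
    act hq hq' hn hadm hm (mulMap hq hq' σ α t) (1 ⊗ₜ 1) = t := by
  induction t using TensorProduct.induction_on with
  | zero => simp
  | add s t hs ht => rw [map_add, map_add, LinearMap.add_apply, hs, ht]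
  | tmul a l =>
    rw [mulMap_tmul, map_mul, Module.End.mul_apply, act_inr_one_tmul_one, act_inl, leftMul_tmul,
      mul_one]

theorem mulMap_act (z : TwoTaft hq' hq σ α) (t : Taft hq' ⊗[k] Taft hq) :
    mulMap hq hq' σ α (act hq hq' hn hadm hm z t) = z * mulMap hq hq' σ α t := by
  suffices ∀ z ∈ Set.range (gen hq' hq σ α), ∀ a l,
      mulMap hq hq' σ α (act hq hq' hn hadm hm z (a ⊗ₜ l)) = z * mulMap hq hq' σ α (a ⊗ₜ l) by
    have on_gen z (hz : z ∈ Set.range (gen hq' hq σ α)) t :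
        mulMap hq hq' σ α (act hq hq' hn hadm hm z t) = z * mulMap hq hq' σ α t := by
      induction t using TensorProduct.induction_on with
      | zero => simp only [map_zero, mul_zero]
      | add s t hs ht => simp only [map_add, mul_add, hs, ht]
      | tmul a l => exact this z hz a l
    have hz : z ∈ Algebra.adjoin k (Set.range (gen hq' hq σ α)) :=
      adjoin_gen hq' hq σ α ▸ Algebra.mem_top
    induction hz using Algebra.adjoin_induction generalizing t with
    | mem z hz => exact on_gen z hz t
    | algebraMap c => rw [AlgHom.commutes, Module.algebraMap_end_apply, map_smul, Algebra.smul_def]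
    | add y z _ _ hy hz => simp only [map_add, LinearMap.add_apply, add_mul, hy, hz]
    | mul y z _ _ hy hz => simp only [map_mul, Module.End.mul_apply, mul_assoc, hy, hz]
  rintro _ ⟨_ | _ | _ | _, rfl⟩ a l
  · change mulMap hq hq' σ α (act hq hq' hn hadm hm (h hq' hq σ α) (a ⊗ₜ l)) = h hq' hq σ α * _
    rw [act, lift_h, actH_tmul, mulMap_tmul, mulMap_tmul, map_mul, inr_h, ← mul_assoc, ← mul_assoc,
      h_mul_inl]
  · change mulMap hq hq' σ α (act hq hq' hn hadm hm (x hq' hq σ α) (a ⊗ₜ l)) = x hq' hq σ α * _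
    rw [act, lift_x, actX_tmul]
    simp only [mulMap_tmul, map_add, map_mul, inr_h, inr_x, ← mul_assoc,
      x_mul_inl hq hq' hn hadm, add_mul]
  · change mulMap hq hq' σ α (act hq hq' hn hadm hm (H hq' hq σ α) (a ⊗ₜ l)) = H hq' hq σ α * _
    rw [act, lift_H, leftMul_tmul, mulMap_tmul, mulMap_tmul, map_mul, inl_h, mul_assoc]
  · change mulMap hq hq' σ α (act hq hq' hn hadm hm (X hq' hq σ α) (a ⊗ₜ l)) = X hq' hq σ α * _
    rw [act, lift_X, leftMul_tmul, mulMap_tmul, mulMap_tmul, map_mul, inl_x, mul_assoc]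

include hn hadm hm in
theorem mulMap_bijective : Function.Bijective (mulMap hq hq' σ α) := by
  refine ⟨Function.LeftInverse.injective
    (g := fun z => act hq hq' hn hadm hm z (1 ⊗ₜ 1)) (act_mulMap_one_tmul_one hq hq' hn hadm hm),
    fun z => ⟨act hq hq' hn hadm hm z (1 ⊗ₜ 1), ?_⟩⟩
  rw [mulMap_act, mulMap_tmul, map_one, map_one, mul_one, mul_one]

end TwoTaft

end BialgHom

namespace FactorsThrough

variable {k A L E E' : Type*} [Field k] [Ring A] [HopfAlgebra k A] [Ring L] [HopfAlgebra k L]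
  [Ring E] [HopfAlgebra k E] [Ring E'] [HopfAlgebra k E']

theorem of_bijective (i : A →ₐc[k] E) (j : L →ₐc[k] E)
    (hij : Function.Bijective (mulTensor i j)) : FactorsThrough k A L E :=
  ⟨i, j, injective_left_of_injective_mulTensor hij.injective,
    injective_right_of_injective_mulTensor hij.injective, hij⟩

theorem of_bialgEquiv (h : FactorsThrough k A L E) (e : E' ≃ₐc[k] E) : FactorsThrough k A L E' := by
  obtain ⟨i, j, -, -, hij⟩ := h
  refine of_bijective ((e.symm : E →ₐc[k] E').comp i) ((e.symm : E →ₐc[k] E').comp j) ?_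
  rw [← comp_mulTensor]
  exact e.symm.bijective.comp hij

end FactorsThrough

namespace TwoTaft

variable {k : Type*} [Field k] {m n : ℕ} [NeZero m] [NeZero n] {q q' σ α : k}

theorem factorsThrough (hq : IsPrimitiveRoot q m) (hq' : IsPrimitiveRoot q' n) (hm : 1 < m)
    (hn : 1 < n) (hadm : IsAdmissible m n q q' σ α) :
    FactorsThrough k (Taft hq') (Taft hq) (TwoTaft hq' hq σ α) :=
  .of_bijective (inl hq hq' σ α) (inr hq hq' σ α) (mulMap_bijective hq hq' hn hadm hm)

end TwoTaft

theorem IsSkewPrimitive.conj {R A : Type*} [CommSemiring R] [Semiring A] [Bialgebra R A] {u : Aˣ}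
    {g y : A} (hu : IsGroupLikeElem R (u : A)) (hy : IsSkewPrimitive R g y) :
    IsSkewPrimitive R (u * g * ↑u⁻¹) (u * y * ↑u⁻¹) := by
  have hu' : IsGroupLikeElem R (↑u⁻¹ : A) := isGroupLikeElem_unitsInv.2 hu
  simp [IsSkewPrimitive, hu.comul_eq_tmul_self, hu'.comul_eq_tmul_self, hy.comul_eq, mul_add,
    add_mul]

theorem mul_eq_smul_mul_of_conj_eq {k B : Type*} [Field k] [Ring B] [Algebra k B] {r c e : k}
    {u g : Bˣ} {y : B} (hug : Commute u g) (hr : r ≠ 1) (hyg : y * g = r • (g * y))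
    (hy : u * y * ↑u⁻¹ = c • y + e • (g - 1)) : u * y = c • (y * u) := by
  have conj_qcomm : (u * y * ↑u⁻¹) * g = r • (g * (u * y * ↑u⁻¹) : B) := by
    have hug' : (↑u⁻¹ * g : B) = g * ↑u⁻¹ := by exact_mod_cast hug.inv_left.eq
    have hug : (u * g : B) = g * u := by exact_mod_cast hug.eq
    rw [mul_assoc, hug', ← mul_assoc, mul_assoc (u : B), hyg, mul_smul_comm, smul_mul_assoc,
      ← mul_assoc, hug, mul_assoc (g : B), mul_assoc (g : B)]
  have e_smul_eq_zero : g * ((1 - r) • e • (g - 1) : B) = 0 := by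
    rw [hy] at conj_qcomm
    simp only [add_mul, mul_add, smul_mul_assoc, mul_smul_comm, hyg, smul_add, sub_mul, mul_sub,
      one_mul, mul_one, smul_comm r c, add_right_inj] at conj_qcomm ⊢
    rw [sub_smul, one_smul, ← conj_qcomm, sub_self]
  rw [g.mul_right_eq_zero, smul_eq_zero_iff_right (sub_ne_zero.2 hr.symm)] at e_smul_eq_zero
  rw [e_smul_eq_zero, add_zero] at hy
  rw [← smul_mul_assoc, ← hy, Units.inv_mul_cancel_right]

theorem comul_mul_sub_smul_mul {R A : Type*} [CommRing R] [Ring A] [Bialgebra R A] {σ τ : R}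
    {h x H X : A} (hx : IsSkewPrimitive R h x) (hX : IsSkewPrimitive R H X)
    (h_mul_H : h * H = H * h) (h_mul_X : h * X = σ • (X * h)) (x_mul_H : x * H = τ • (H * x)) :
    comul (R := R) (x * X - σ • (X * x)) = (x * X - σ • (X * x)) ⊗ₜ (H * h) +
      1 ⊗ₜ (x * X - σ • (X * x)) + (τ - σ) • (X ⊗ₜ[R] (H * x)) := by
  simp only [map_sub, map_smul, Bialgebra.comul_mul, hx.comul_eq, hX.comul_eq, mul_add, add_mul,
    Algebra.TensorProduct.tmul_mul_tmul, one_mul, mul_one, h_mul_H, h_mul_X, x_mul_H,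
    TensorProduct.tmul_smul, TensorProduct.sub_tmul, TensorProduct.tmul_sub,
    ← TensorProduct.smul_tmul']
  module

namespace TwoTaftRelations

variable {k B : Type*} [Field k] [Ring B] [Algebra k B] {m n : ℕ} {q q' σ α : k} {h x H X : B}

theorem h_mul_commutator (w : TwoTaftRelations m n q q' σ α h x H X) :
    q • (h * (x * X - σ • (X * x))) = σ • ((x * X - σ • (X * x)) * h) := by
  have h_x_X : q • (h * x * X) = σ • (x * X * h) := by
    rw [← smul_mul_assoc, ← w.x_mul_h, mul_assoc, w.h_mul_X, mul_smul_comm, mul_assoc]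
  have h_X_x : q • (h * X * x) = σ • (X * x * h) := by
    rw [w.h_mul_X, smul_mul_assoc, mul_assoc, mul_assoc, w.x_mul_h, mul_smul_comm, smul_comm]
  rw [mul_sub, sub_mul, smul_sub, smul_sub, ← mul_assoc, h_x_X, mul_smul_comm, smul_comm q σ,
    ← mul_assoc, h_X_x, smul_mul_assoc]

theorem commutator_mul_H (w : TwoTaftRelations m n q q' σ α h x H X) :
    (x * X - σ • (X * x)) * H = (q' * σ) • (H * (x * X - σ • (X * x))) := by
  have x_X_H : x * X * H = (q' * σ) • (H * (x * X)) := by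
    rw [mul_assoc, w.X_mul_H, mul_smul_comm, ← mul_assoc, w.x_mul_H, smul_mul_assoc, smul_smul,
      mul_assoc]
  have X_x_H : X * x * H = (q' * σ) • (H * (X * x)) := by
    rw [mul_assoc, w.x_mul_H, mul_smul_comm, ← mul_assoc, w.X_mul_H, smul_mul_assoc, smul_smul,
      mul_assoc, mul_comm σ]
  rw [sub_mul, mul_sub, smul_sub, x_X_H, smul_mul_assoc, X_x_H, mul_smul_comm, smul_comm σ]

theorem eq_zero_or [NeZero m] [NeZero n] (w : TwoTaftRelations m n q q' σ α h x H X)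
    (Hh_ne_one : H * h ≠ 1) : α = 0 ∨ σ = q ∧ q' * q = 1 := by
  refine or_iff_not_imp_left.2 fun hα => ?_
  have commutator_ne_zero : x * X - σ • (X * x) ≠ 0 :=
    w.x_mul_X ▸ smul_ne_zero hα (sub_ne_zero.2 Hh_ne_one.symm)
  have commute_Hh_h : Commute (H * h) h := .mul_left w.h_mul_H.symm rfl
  have commute_Hh_H : Commute (H * h) H := .mul_left rfl w.h_mul_H
  have commute_h : h * (x * X - σ • (X * x)) = (x * X - σ • (X * x)) * h := by
    rw [w.x_mul_X]
    exact (((Commute.one_left h).sub_left commute_Hh_h).smul_left α).symm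
  have commute_H : H * (x * X - σ • (X * x)) = (x * X - σ • (X * x)) * H := by
    rw [w.x_mul_X]
    exact (((Commute.one_left H).sub_left commute_Hh_H).smul_left α).symm
  have q_eq : q = σ := by
    refine smul_left_injective k ?_ (w.h_mul_commutator.trans (by rw [← commute_h]))
    exact mt (IsUnit.of_pow_eq_one w.h_pow (NeZero.ne m)).mul_right_eq_zero.1 commutator_ne_zero
  have mul_eq_one : q' * σ = 1 := by
    refine smul_left_injective k ?_
      (w.commutator_mul_H.symm.trans (commute_H.symm.trans (one_smul k _).symm))
    exact mt (IsUnit.of_pow_eq_one w.H_pow (NeZero.ne n)).mul_right_eq_zero.1 commutator_ne_zero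
  exact ⟨q_eq.symm, q_eq ▸ mul_eq_one⟩

theorem isAdmissible [NeZero m] [NeZero n] (w : TwoTaftRelations m n q q' σ α h x H X)
    (x_ne_zero : x ≠ 0) (X_ne_zero : X ≠ 0) (Hh_ne_one : H * h ≠ 1) :
    IsAdmissible m n q q' σ α where
  pow_left := by
    have := mul_pow_of_qcomm w.x_mul_H n
    rw [w.H_pow, one_mul, mul_one] at this
    exact smul_left_injective k x_ne_zero (this.symm.trans (one_smul k x).symm)
  pow_right := by
    have := pow_mul_of_qcomm w.h_mul_X m
    rw [w.h_pow, one_mul, mul_one] at this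
    exact smul_left_injective k X_ne_zero (this.symm.trans (one_smul k X).symm)
  eq_zero_or := w.eq_zero_or Hh_ne_one

end TwoTaftRelations

section mulTensorEquiv

variable {R A L E : Type*} [CommSemiring R] [Semiring A] [Bialgebra R A] [Semiring L]
  [Bialgebra R L] [Semiring E] [Bialgebra R E] {i : A →ₐc[R] E} {j : L →ₐc[R] E}

/-- The multiplication map of a factorization as an isomorphism of coalgebras. -/
noncomputable def mulTensorEquiv (hij : Function.Bijective (mulTensor i j)) :
    A ⊗[R] L ≃ₗc[R] E :=
  CoalgEquiv.ofBijective (f := (Bialgebra.mulCoalgHom R E).comp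
    (Coalgebra.TensorProduct.map (i : A →ₗc[R] E) (j : L →ₗc[R] E))) hij

theorem mulTensorEquiv_symm_mul (hij : Function.Bijective (mulTensor i j)) (a : A) (l : L) :
    (mulTensorEquiv hij).symm (i a * j l) = a ⊗ₜ l :=
  (mulTensorEquiv hij).symm_apply_apply (a ⊗ₜ l)

theorem mulTensorEquiv_symm_left (hij : Function.Bijective (mulTensor i j)) (a : A) :
    (mulTensorEquiv hij).symm (i a) = a ⊗ₜ 1 := by
  simpa using mulTensorEquiv_symm_mul hij a 1

theorem mulTensorEquiv_symm_right (hij : Function.Bijective (mulTensor i j)) (l : L) :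
    (mulTensorEquiv hij).symm (j l) = 1 ⊗ₜ l := by
  simpa using mulTensorEquiv_symm_mul hij 1 l

theorem mulTensorEquiv_symm_one (hij : Function.Bijective (mulTensor i j)) :
    (mulTensorEquiv hij).symm 1 = 1 := by
  simpa [Algebra.TensorProduct.one_def] using mulTensorEquiv_symm_left hij 1

end mulTensorEquiv

namespace Taft

variable {k : Type*} [Field k] {m : ℕ} {q : k} (hq : IsPrimitiveRoot q m)

theorem h_ne_one [NeZero m] (hm : 1 < m) : h hq ≠ 1 := fun e =>
  hq.ne_one hm (by simpa using congrArg (character hq) e)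

theorem x_ne_smul_h_sub_one [NeZero m] (hm : 1 < m) (e : k) :
    x hq ≠ e • (h hq - 1) := fun x_eq => by
  have := congrArg (dualX hq hm) x_eq
  rw [dualX_x, map_smul, map_sub, dualX_h, dualX_one, sub_zero, smul_zero] at this
  exact one_ne_zero this

theorem x_ne_zero [NeZero m] (hm : 1 < m) : x hq ≠ 0 := by
  simpa using x_ne_smul_h_sub_one hq hm 0

end Taft

section Factorization

variable {k E : Type*} [Field k] [Ring E] [Bialgebra k E] {m n : ℕ} [NeZero m] [NeZero n]
  {q q' : k} {hq : IsPrimitiveRoot q m} {hq' : IsPrimitiveRoot q' n} {i : Taft hq' →ₐc[k] E}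
  {j : Taft hq →ₐc[k] E} (hij : Function.Bijective (mulTensor i j)) (hm : 1 < m) (hn : 1 < n)

include hij hn in
theorem map_h_mul_map_ne {l l' : Taft hq} (hl : counit (R := k) l = 1)
    (hl' : counit (R := k) l' = 1) : i (Taft.h hq') * j l ≠ j l' := by
  intro e
  have e' := congrArg (mulTensorEquiv hij).symm e
  rw [mulTensorEquiv_symm_mul, mulTensorEquiv_symm_right] at e'
  have := congrArg (TensorProduct.dualDistrib k _ _
    ((Taft.character hq').toLinearMap ⊗ₜ (counit : Taft hq →ₗ[k] k))) e'
  exact hq'.ne_one hn (by simpa [hl, hl'] using this)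

include hij hn in
theorem map_h_ne_map_h : i (Taft.h hq') ≠ j (Taft.h hq) := by
  simpa using map_h_mul_map_ne hij hn (l := 1) (l' := Taft.h hq) (by simp) (Taft.counit_h hq)

include hij hn in
theorem map_h_mul_map_h_ne_one : i (Taft.h hq') * j (Taft.h hq) ≠ 1 := by
  simpa using map_h_mul_map_ne hij hn (l' := 1) (Taft.counit_h hq) (by simp)

include hij hn in
theorem left_h_ne_one : i (Taft.h hq') ≠ 1 := by
  simpa using map_h_mul_map_ne hij hn (l := 1) (l' := 1) (by simp) (by simp)

include hij hm in
theorem right_h_ne_one : j (Taft.h hq) ≠ 1 := fun e =>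
  Taft.h_ne_one hq hm (injective_right_of_injective_mulTensor hij.injective (by rw [e, map_one]))

include hij hm hn in
theorem exists_eq_of_isSkewPrimitive_of_bijective {g y : E} (hg : IsGroupLikeElem k g)
    (hg1 : g ≠ 1) (hy : IsSkewPrimitive k g y) :
    ∃ c d e : k, y = c • i (Taft.x hq') + d • j (Taft.x hq) + e • (g - 1) ∧
      (c ≠ 0 → g = i (Taft.h hq')) ∧ (d ≠ 0 → g = j (Taft.h hq)) := by
  have Ψ_inj : Function.Injective (mulTensorEquiv hij).symm := (mulTensorEquiv hij).symm.injective
  have Ψ_one := mulTensorEquiv_symm_one hij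
  obtain ⟨c, d, e, he, hc, hd⟩ := exists_eq_of_isSkewPrimitive hq hq' hm hn
    (hg.map (mulTensorEquiv hij).symm) (Ψ_one ▸ Ψ_inj.ne hg1)
    (hy.map (mulTensorEquiv hij).symm Ψ_one)
  refine ⟨c, d, e, Ψ_inj ?_, fun h => Ψ_inj ?_, fun h => Ψ_inj ?_⟩
  · rw [he, map_add, map_add, map_smul, map_smul, map_smul, map_sub, mulTensorEquiv_symm_left,
      mulTensorEquiv_symm_right, Ψ_one]
  · rw [hc h, mulTensorEquiv_symm_left]
  · rw [hd h, mulTensorEquiv_symm_right]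

include hij hm hn in
theorem eq_zero_of_comul_eq_add_smul_of_bijective {g z : E} {c : k} (hg : IsGroupLikeElem k g)
    (hz : comul (R := k) z = z ⊗ₜ g + 1 ⊗ₜ z +
      c • (i (Taft.x hq') ⊗ₜ[k] (i (Taft.h hq') * j (Taft.x hq)))) : c = 0 := by
  refine eq_zero_of_comul_eq_add_smul hq hq' hm hn (z := (mulTensorEquiv hij).symm z)
    (hg.map (mulTensorEquiv hij).symm) ?_
  rw [← CoalgHomClass.map_comp_comul_apply, hz]
  simp [mulTensorEquiv_symm_mul, mulTensorEquiv_symm_left, mulTensorEquiv_symm_one]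

include hij hm hn in
theorem exists_eq_smul_left_add {y : E} (hy : IsSkewPrimitive k (i (Taft.h hq')) y) :
    ∃ c e : k, y = c • i (Taft.x hq') + e • (i (Taft.h hq') - 1) := by
  obtain ⟨c, d, e, hy, -, hd⟩ := exists_eq_of_isSkewPrimitive_of_bijective hij hm hn
    ((Taft.isGroupLikeElem_h hq').map i) (left_h_ne_one hij hn) hy
  obtain rfl : d = 0 := by_contra fun hd0 => map_h_ne_map_h hij hn (hd hd0)
  exact ⟨c, e, by rw [hy, zero_smul, add_zero]⟩

include hij hm hn in
theorem exists_eq_smul_right_add {y : E} (hy : IsSkewPrimitive k (j (Taft.h hq)) y) :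
    ∃ d e : k, y = d • j (Taft.x hq) + e • (j (Taft.h hq) - 1) := by
  obtain ⟨c, d, e, hy, hc, -⟩ := exists_eq_of_isSkewPrimitive_of_bijective hij hm hn
    ((Taft.isGroupLikeElem_h hq).map j) (right_h_ne_one hij hm) hy
  obtain rfl : c = 0 := by_contra fun hc0 => map_h_ne_map_h hij hn (hc hc0).symm
  exact ⟨d, e, by rw [hy, zero_smul, zero_add]⟩

include hij hm hn in
theorem exists_eq_smul_one_sub {y : E}
    (hy : IsSkewPrimitive k (i (Taft.h hq') * j (Taft.h hq)) y) :
    ∃ α : k, y = α • (1 - i (Taft.h hq') * j (Taft.h hq)) := by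
  have H_grp := (Taft.isGroupLikeElem_h hq').map i
  have h_grp := (Taft.isGroupLikeElem_h hq).map j
  obtain ⟨c, d, e, hy, hc, hd⟩ := exists_eq_of_isSkewPrimitive_of_bijective hij hm hn
    (H_grp.mul h_grp) (map_h_mul_map_h_ne_one hij hn) hy
  obtain rfl : c = 0 := by_contra fun hc0 => right_h_ne_one hij hm
    (((Taft.isGroupLikeElem_h hq').isUnit.map i).mul_eq_left.1 (hc hc0))
  obtain rfl : d = 0 := by_contra fun hd0 => left_h_ne_one hij hn
    (((Taft.isGroupLikeElem_h hq).isUnit.map j).mul_eq_right.1 (hd hd0))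
  exact ⟨-e, by rw [hy, zero_smul, zero_smul, zero_add, zero_add, neg_smul, ← smul_neg, neg_sub]⟩

include hij hm hn in
theorem commute_map_h : Commute (j (Taft.h hq)) (i (Taft.h hq')) := by
  obtain ⟨u, hu⟩ := (Taft.isGroupLikeElem_h hq).isUnit.map j
  have u_grp : IsGroupLikeElem k (u : E) := hu ▸ (Taft.isGroupLikeElem_h hq).map j
  have H_grp := (Taft.isGroupLikeElem_h hq').map i
  have conj_ne_one : (u * i (Taft.h hq') * ↑u⁻¹ : E) ≠ 1 := by
    rw [Ne, Units.mul_inv_eq_one]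
    exact fun h => left_h_ne_one hij hn (u.isUnit.mul_eq_left.1 h)
  obtain ⟨c, d, e, hy, hc, hd⟩ := exists_eq_of_isSkewPrimitive_of_bijective hij hm hn
    ((u_grp.mul H_grp).mul (isGroupLikeElem_unitsInv.2 u_grp)) conj_ne_one
    (((Taft.isSkewPrimitive_x hq').map i (map_one i)).conj u_grp)
  rw [← hu]
  suffices c ≠ 0 from (Units.mul_inv_eq_iff_eq_mul u).1 (hc this)
  rintro rfl
  obtain rfl : d = 0 := by_contra fun hd0 => map_h_ne_map_h hij hn
    (hu ▸ u.mul_right_inj.1 ((Units.mul_inv_eq_iff_eq_mul u).1 (hu ▸ hd hd0)))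
  have conj_X : (u * i (Taft.x hq') * ↑u⁻¹ : E) = u * (e • (i (Taft.h hq') - 1)) * ↑u⁻¹ := by
    rw [hy, mul_smul_comm, smul_mul_assoc, mul_sub, sub_mul, mul_one, u.mul_inv, zero_smul,
      zero_smul, zero_add, zero_add]
  have X_eq := u.mul_right_inj.1 ((u⁻¹).mul_left_inj.1 conj_X)
  rw [← map_one i, ← map_sub, ← map_smul] at X_eq
  exact Taft.x_ne_smul_h_sub_one hq' hn e (injective_left_of_injective_mulTensor hij.injective X_eq)

include hij hm hn in
theorem exists_h_mul_X :
    ∃ σ : k, j (Taft.h hq) * i (Taft.x hq') = σ • (i (Taft.x hq') * j (Taft.h hq)) := by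
  obtain ⟨u, hu⟩ := (Taft.isGroupLikeElem_h hq).isUnit.map j
  obtain ⟨v, hv⟩ := (Taft.isGroupLikeElem_h hq').isUnit.map i
  have u_grp : IsGroupLikeElem k (u : E) := hu ▸ (Taft.isGroupLikeElem_h hq).map j
  have u_mul_v : Commute (u : E) v := hu ▸ hv ▸ commute_map_h hij hm hn
  have conj_X := ((Taft.isSkewPrimitive_x hq').map i (map_one i)).conj u_grp
  rw [← hv, u_mul_v.eq, Units.mul_inv_cancel_right, hv] at conj_X
  obtain ⟨σ, e, he⟩ := exists_eq_smul_left_add hij hm hn conj_X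
  refine ⟨σ, hu ▸ mul_eq_smul_mul_of_conj_eq (Commute.units_val_iff.1 u_mul_v) (hq'.ne_one hn) ?_
    (hv ▸ he)⟩
  rw [hv, ← map_mul, Taft.x_mul_h, map_smul, map_mul]

include hij hm hn in
theorem exists_x_mul_H :
    ∃ τ : k, j (Taft.x hq) * i (Taft.h hq') = τ • (i (Taft.h hq') * j (Taft.x hq)) := by
  obtain ⟨u, hu⟩ := (Taft.isGroupLikeElem_h hq).isUnit.map j
  obtain ⟨v, hv⟩ := (Taft.isGroupLikeElem_h hq').isUnit.map i
  have v_grp : IsGroupLikeElem k (v : E) := hv ▸ (Taft.isGroupLikeElem_h hq').map i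
  have u_mul_v : Commute (u : E) v := hu ▸ hv ▸ commute_map_h hij hm hn
  have conj_x := ((Taft.isSkewPrimitive_x hq).map j (map_one j)).conj
    (isGroupLikeElem_unitsInv.2 v_grp)
  rw [← hu, inv_inv, mul_assoc _ (u : E), u_mul_v.eq, Units.inv_mul_cancel_left, hu] at conj_x
  obtain ⟨τ, e, he⟩ := exists_eq_smul_right_add hij hm hn conj_x
  have inv_mul_x := mul_eq_smul_mul_of_conj_eq (u := v⁻¹) (g := u)
    (Commute.units_val_iff.1 u_mul_v).symm.inv_left (hq.ne_one hm)
    (by rw [hu, ← map_mul, Taft.x_mul_h, map_smul, map_mul]) (hu ▸ he)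
  refine ⟨τ, ?_⟩
  rw [← hv, ← Units.eq_mul_inv_iff_mul_eq, smul_mul_assoc, mul_assoc, ← mul_smul_comm, ← inv_mul_x,
    Units.mul_inv_cancel_left]

include hij hm hn in
theorem exists_twoTaftRelations : ∃ σ α : k, TwoTaftRelations m n q q' σ α (j (Taft.h hq))
    (j (Taft.x hq)) (i (Taft.h hq')) (i (Taft.x hq')) := by
  have h_grp := (Taft.isGroupLikeElem_h hq).map j
  have H_grp := (Taft.isGroupLikeElem_h hq').map i
  obtain ⟨σ, h_mul_X⟩ := exists_h_mul_X hij hm hn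
  obtain ⟨τ, x_mul_H⟩ := exists_x_mul_H hij hm hn
  have comul_commutator := comul_mul_sub_smul_mul ((Taft.isSkewPrimitive_x hq).map j (map_one j))
    ((Taft.isSkewPrimitive_x hq').map i (map_one i)) (commute_map_h hij hm hn) h_mul_X x_mul_H
  have τ_sub_σ_eq_zero : τ - σ = 0 := eq_zero_of_comul_eq_add_smul_of_bijective hij hm hn
    (H_grp.mul h_grp) comul_commutator
  rw [τ_sub_σ_eq_zero, zero_smul, add_zero] at comul_commutator
  obtain rfl : τ = σ := sub_eq_zero.1 τ_sub_σ_eq_zero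
  obtain ⟨α, x_mul_X⟩ := exists_eq_smul_one_sub hij hm hn comul_commutator
  exact ⟨τ, α,
    { h_pow := by rw [← map_pow, Taft.h_pow, map_one]
      H_pow := by rw [← map_pow, Taft.h_pow, map_one]
      x_pow := by rw [← map_pow, Taft.x_pow, map_zero]
      X_pow := by rw [← map_pow, Taft.x_pow, map_zero]
      x_mul_h := by rw [← map_mul, Taft.x_mul_h, map_smul, map_mul]
      X_mul_H := by rw [← map_mul, Taft.x_mul_h, map_smul, map_mul]
      x_mul_H := x_mul_H
      h_mul_X := h_mul_X
      x_mul_X := x_mul_X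
      h_mul_H := commute_map_h hij hm hn }⟩

include hij hm hn in
theorem exists_bialgEquiv_twoTaft :
    ∃ σ α : k, IsAdmissible m n q q' σ α ∧ Nonempty (E ≃ₐc[k] TwoTaft hq' hq σ α) := by
  obtain ⟨σ, α, w⟩ := exists_twoTaftRelations hij hm hn
  have i_inj := injective_left_of_injective_mulTensor hij.injective
  have j_inj := injective_right_of_injective_mulTensor hij.injective
  have hadm : IsAdmissible m n q q' σ α := w.isAdmissible
    (map_zero j ▸ j_inj.ne (Taft.x_ne_zero hq hm)) (map_zero i ▸ i_inj.ne (Taft.x_ne_zero hq' hn))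
    (map_h_mul_map_h_ne_one hij hn)
  let f : TwoTaft hq' hq σ α →ₐc[k] E := TwoTaft.liftBialgHom hq hq' w
    ((Taft.isGroupLikeElem_h hq).map j) ((Taft.isSkewPrimitive_x hq).map j (map_one j))
    ((Taft.isGroupLikeElem_h hq').map i) ((Taft.isSkewPrimitive_x hq').map i (map_one i))
  have f_inl : f.comp (TwoTaft.inl hq hq' σ α) = i :=
    Taft.bialgHom_ext hq' (by simp [f]) (by simp [f])
  have f_inr : f.comp (TwoTaft.inr hq hq' σ α) = j :=
    Taft.bialgHom_ext hq (by simp [f]) (by simp [f])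
  have f_bijective : Function.Bijective f := by
    rw [← (TwoTaft.mulMap_bijective hq hq' hn hadm hm).of_comp_iff]
    rw [← f_inl, ← f_inr, ← comp_mulTensor] at hij
    exact hij
  exact ⟨σ, α, hadm, ⟨(BialgEquiv.ofBijective f f_bijective).symm⟩⟩

end Factorization

theorem factorsThrough_iff {k E : Type*} [Field k] [Ring E] [HopfAlgebra k E] {m n : ℕ}
    [NeZero m] [NeZero n] {q q' : k} (hq : IsPrimitiveRoot q m) (hq' : IsPrimitiveRoot q' n)
    (hm : 1 < m) (hn : 1 < n) :
    FactorsThrough k (Taft hq') (Taft hq) E ↔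
      ∃ σ α : k, IsAdmissible m n q q' σ α ∧ Nonempty (E ≃ₐc[k] TwoTaft hq' hq σ α) := by
  refine ⟨?_, ?_⟩
  · rintro ⟨i, j, -, -, hij⟩
    exact exists_bialgEquiv_twoTaft hij hm hn
  · rintro ⟨σ, α, hadm, ⟨e⟩⟩
    exact (TwoTaft.factorsThrough hq hq' hm hn hadm).of_bialgEquiv e

theorem IsAdmissible.eq_zero_of_ne {k : Type*} [Field k] {m n : ℕ} [NeZero n] {q q' σ α : k}
    (hadm : IsAdmissible m n q q' σ α) (hq : IsPrimitiveRoot q m) (hq' : IsPrimitiveRoot q' n)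
    (hne : m ≠ n ∨ q' ≠ q ^ (n - 1)) : α = 0 := by
  refine hadm.eq_zero_or.resolve_right fun ⟨_, q'_mul_q⟩ => ?_
  obtain rfl : m = n := hq.inv.unique (eq_inv_of_mul_eq_one_left q'_mul_q ▸ hq')
  refine hne.elim (· rfl) (· ?_)
  rw [← one_mul (q ^ (m - 1)), ← q'_mul_q, mul_assoc, TwoTaft.mul_pow_pred hq.pow_eq_one, mul_one]

end TaftBicrossed

theorem mainTheorem2_general {k : Type*} [Field k] {m n : ℕ} [NeZero m] [NeZero n]
    (hm : m ≠ 1) (hn : n ≠ 1) {q q' : k} (hq : IsPrimitiveRoot q m) (hq' : IsPrimitiveRoot q' n)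
    {E : Type*} [Ring E] [HopfAlgebra k E] :
    (m ≠ n ∨ q' ≠ q ^ (n - 1) →
      (TaftBicrossed.FactorsThrough k (TaftBicrossed.Taft hq') (TaftBicrossed.Taft hq) E ↔
        ∃ σ : k, σ ^ Nat.gcd m n = 1 ∧
          Nonempty (E ≃ₐc[k] TaftBicrossed.TaftSigma hq' hq σ))) ∧
    (∀ hmn : m = n, q' = q ^ (n - 1) →
      (TaftBicrossed.FactorsThrough k (TaftBicrossed.Taft hq') (TaftBicrossed.Taft hq) E ↔
        (∃ σ : k, σ ^ n = 1 ∧ Nonempty (E ≃ₐc[k] TaftBicrossed.TaftSigma hq' hq σ)) ∨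
        (∃ α : k, α ≠ 0 ∧ Nonempty (E ≃ₐc[k] TaftBicrossed.TaftQ
          (show IsPrimitiveRoot q n from hmn ▸ hq) α)))) := by
  have hm' : 1 < m := Nat.one_lt_iff_ne_zero_and_ne_one.2 ⟨NeZero.ne m, hm⟩
  have hn' : 1 < n := Nat.one_lt_iff_ne_zero_and_ne_one.2 ⟨NeZero.ne n, hn⟩
  rw [TaftBicrossed.factorsThrough_iff hq hq' hm' hn']
  refine ⟨fun hne => exists_congr fun σ => ?_, ?_⟩
  · refine ⟨?_, ?_⟩
    · rintro ⟨α, hadm, e⟩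
      obtain rfl : α = 0 := hadm.eq_zero_of_ne hq hq' hne
      exact ⟨pow_gcd_eq_one.2 ⟨hadm.pow_right, hadm.pow_left⟩, e⟩
    · rintro ⟨hσ, e⟩
      obtain ⟨σ_pow_m, σ_pow_n⟩ := pow_gcd_eq_one.1 hσ
      exact ⟨0, ⟨σ_pow_n, σ_pow_m, .inl rfl⟩, e⟩
  · rintro rfl rfl
    refine ⟨?_, ?_⟩
    · rintro ⟨σ, α, hadm, e⟩
      obtain rfl | hα := eq_or_ne α 0
      · exact .inl ⟨σ, hadm.pow_left, e⟩
      · obtain ⟨rfl, -⟩ := hadm.eq_zero_or.resolve_left hα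
        exact .inr ⟨α, hα, e⟩
    · rintro (⟨σ, hσ, e⟩ | ⟨α, -, e⟩)
      · exact ⟨σ, 0, ⟨hσ, hσ, .inl rfl⟩, e⟩
      · exact ⟨q, α, ⟨hq.pow_eq_one, hq.pow_eq_one,
          .inr ⟨rfl, TaftBicrossed.TwoTaft.pow_pred_mul hq.pow_eq_one⟩⟩, e⟩

theorem mainTheorem2 {k : Type*} [Field k] [CharZero k] {m n : ℕ} [NeZero m] [NeZero n]
    (hm : m ≠ 1) (hn : n ≠ 1) {q q' : k} (hq : IsPrimitiveRoot q m) (hq' : IsPrimitiveRoot q' n)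
    {E : Type*} [Ring E] [HopfAlgebra k E] :
    (m ≠ n ∨ q' ≠ q ^ (n - 1) →
      (TaftBicrossed.FactorsThrough k (TaftBicrossed.Taft hq') (TaftBicrossed.Taft hq) E ↔
        ∃ σ : k, σ ^ Nat.gcd m n = 1 ∧
          Nonempty (E ≃ₐc[k] TaftBicrossed.TaftSigma hq' hq σ))) ∧
    (∀ hmn : m = n, q' = q ^ (n - 1) →
      (TaftBicrossed.FactorsThrough k (TaftBicrossed.Taft hq') (TaftBicrossed.Taft hq) E ↔
        (∃ σ : k, σ ^ n = 1 ∧ Nonempty (E ≃ₐc[k] TaftBicrossed.TaftSigma hq' hq σ)) ∨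
        (∃ α : k, α ≠ 0 ∧ Nonempty (E ≃ₐc[k] TaftBicrossed.TaftQ (show IsPrimitiveRoot q n from hmn ▸ hq) α)))) :=
  mainTheorem2_general hm hn hq hq'
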